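/- Let $d,m,n\geq 2$ be integers and let $\zeta\in\mathbb{C}$ satisfy $\zeta^d=1$, $\zeta\neq 1$. Define polynomials $a_i\in\mathbb{Z}[c]$ by $a_0=0$ and $a_{i+1}=a_i^d+c$ (so $a_1=c$). For $t\geq 1$ let $$G_{d,m,t}^{\zeta}(c)=\prod_{k\mid t}\bigl(a_{m+k-1}-\zeta a_{m-1}\bigr)^{\mu(t/k)}\cdot\begin{cases}\prod_{k\mid t}a_k^{-\mu(t/k)} & \text{if } t\mid m-1,\\ 1 & \text{if } t\nmid m-1,\end{cases}$$ where $\mu$ is the Möbius function; this is a monic polynomial in $\mathbb{Z}[\zeta][c]$. If $\alpha\in\mathbb{C}$ is a root of $G_{d,m,t}^{\zeta}$, the multiplier of the cycle $\{a_m(\alpha),\dots,a_{m+t-1}(\alpha)\}$ of $z\mapsto z^d+\alpha$ is $$\lambda_{d,m,t}(\alpha)=d^t\Bigl(\prod_{i=0}^{t-1}a_{m+i}(\alpha)\Bigr)^{d-1},$$ and the multiplier polynomial is $P_{d,m,t}^{\zeta}(x)=\prod_{j}\bigl(x-\lambda_{d,m,t}(\alpha_j)\bigr)\in\mathbb{Z}[\zeta][x]$,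 where $\alpha_j$ runs over all complex roots of $G_{d,m,t}^{\zeta}$. Let $\Phi_i$ denote the $i$-th cyclotomic polynomial. Let $c_0\in\mathbb{C}$ be a root of $G_{d,m,n}^{\zeta}$, let $K=\mathbb{Q}(c_0)$, and let $\mathcal{O}_K$ be its ring of integers. Assume that $G_{d,m,t}^{\zeta}$ is irreducible over $\mathbb{Q}(\zeta)$ for every positive divisor $t$ of $n$. Let $\ell\geq 1$ be a divisor of $n$ with $\ell\neq n$, and suppose that the resultant $\mathrm{Res}(P_{d,m,\ell}^{\zeta},\Phi_{n/\ell})$ is not a unit in $\mathbb{Z}[\zeta]$. Then $G_{d,m,\ell}^{\zeta}(c_0)$ is an element of $\mathcal{O}_K$ that is not a unit in $\mathcal{O}_K$. -/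

import Mathlib

open Polynomial
open scoped IntermediateField NumberField

noncomputable section

namespace Misiurewicz

/-- The critical orbit of the generic unicritical polynomial `z ^ d + c`: the polynomial `a_i` in the
parameter `c = X`, given by `a_0 = 0` and `a_(i+1) = a_i ^ d + c` (so that `a_1 = c` for `d ≥ 1`). -/
def critOrbit (F : Type*) [CommRing F] (d : ℕ) : ℕ → F[X]
  | 0 => 0
  | i + 1 => critOrbit F d i ^ d + X

/-- The Möbius product
`∏_{k ∣ n} (a_(m+k-1) - ζ a_(m-1)) ^ μ(n/k)`, multiplied by `∏_{k ∣ n} a_k ^ (-μ(n/k))` when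
`n ∣ m - 1`, as a rational function of the parameter. It is used for `m ≥ 2` and `n ≥ 1`. -/
def misiurewiczRat {F : Type*} [Field F] (d m n : ℕ) (ζ : F) : RatFunc F :=
  (∏ k ∈ n.divisors,
      algebraMap F[X] (RatFunc F) (critOrbit F d (m + k - 1) - C ζ * critOrbit F d (m - 1)) ^
        (ArithmeticFunction.moebius (n / k))) *
    if n ∣ m - 1 then
      ∏ k ∈ n.divisors,
        algebraMap F[X] (RatFunc F) (critOrbit F d k) ^ (-ArithmeticFunction.moebius (n / k))
    else 1

/-- The Misiurewicz polynomial `G_{d,m,n}^ζ` with coefficients in `ℚ(ζ)`, where `ζ ∈ ℂ`.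
For `d, m ≥ 2`, `n ≥ 1` and `ζ ≠ 1` a `d`-th root of unity, the rational function above is a
(monic) polynomial, and that polynomial is its numerator. -/
def misiurewicz (d m n : ℕ) (ζ : ℂ) : ℚ⟮ζ⟯[X] :=
  (misiurewiczRat d m n (IntermediateField.AdjoinSimple.gen ℚ ζ)).num

/-- The multiplier of the cycle `{a_m(c), …, a_(m+n-1)(c)}` of `z ^ d + c` (see
`multiplier_eq_deriv`), for a parameter `c` at which `a_(m+n)(c) = a_m(c)`. -/
def multiplier (d m n : ℕ) (c : ℂ) : ℂ :=
  (d : ℂ) ^ n * (∏ i ∈ Finset.range n, (critOrbit ℂ d (m + i)).eval c) ^ (d - 1)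

/-- The multiplier polynomial `P_{d,m,n}^ζ`: the product of `x - λ(c)` over all complex roots `c`
of `G_{d,m,n}^ζ`, where `λ(c)` is the multiplier. -/
def multiplierPoly (d m n : ℕ) (ζ : ℂ) : ℂ[X] :=
  (((misiurewicz d m n ζ).aroots ℂ).map fun c => X - C (multiplier d m n c)).prod

theorem eval_critOrbit (d i : ℕ) (c : ℂ) :
    (critOrbit ℂ d i).eval c = (fun z : ℂ => z ^ d + c)^[i] 0 := by
  induction i with
  | zero => simp [critOrbit]
  | succ i ih => simp [critOrbit, Function.iterate_succ_apply', ih]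

/-- The number `multiplier d m n c` is the derivative of the `n`-th iterate of `z ^ d + c` at the
point `a_m(c)`. -/
theorem multiplier_eq_deriv (d m n : ℕ) (c : ℂ) :
    HasDerivAt ((fun z : ℂ => z ^ d + c)^[n]) (multiplier d m n c)
      ((critOrbit ℂ d m).eval c) := by
  induction n with
  | zero => simpa [multiplier] using hasDerivAt_id _
  | succ n ih =>
    rw [Function.iterate_succ']
    have hpt : (fun z : ℂ => z ^ d + c)^[n] ((critOrbit ℂ d m).eval c)
        = (critOrbit ℂ d (m + n)).eval c := by
      rw [eval_critOrbit, eval_critOrbit, ← Function.iterate_add_apply, add_comm]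
    have h1 : HasDerivAt (fun z : ℂ => z ^ d + c)
        (d * (critOrbit ℂ d (m + n)).eval c ^ (d - 1))
        ((fun z : ℂ => z ^ d + c)^[n] ((critOrbit ℂ d m).eval c)) := by
      rw [hpt]
      exact (hasDerivAt_pow d _).add_const c
    have h2 := h1.comp _ ih
    refine h2.congr_deriv ?_
    simp only [multiplier, Finset.prod_range_succ, mul_pow, pow_succ]
    ring

end Misiurewicz

end

/-! Write G_t for the Misiurewicz polynomials, λ for the multiplier and s = n/ℓ, and work by
contraposition in the ring A of all algebraic integers. If G_ℓ(c₀) is a unit, irreducibility of G_n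
makes G_ℓ(b) a unit at every root b of G_n (`isIntegral_inv_aeval_of_conj`). So all differences b -
a with a a root of G_ℓ are units, and hence so is each G_n(a) (`isUnit_eval_swap`). Then Φ_s(λ(a))
is a unit as well, since a maximal ideal containing it would contain G_n(a)
(`isUnit_eval_cyclotomic`). The resultant is the product of the Φ_s(λ(a)): a unit of A lying in
ℚ(ζ), hence a unit of ℤ[ζ].

The reduction step needs the roots of G_t over a field of any characteristic
(`IsPolynomial.isRoot_iff`). With f(z) = z^d + c and y = ζ a_(m-1), the condition ζ^d = 1 gives
f^k(y) = a_(m+k-1) for k ≥ 1, so the Möbius product is a dynatomic product at y. If y has exact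
period N and multiplier x at α, the order of f^(Nj)(y) - y at α jumps at j = 1 and at those j ≥ 2
with Φ_j(x) = 0. Möbius inversion makes the order of the product positive there and zero elsewhere
(`moebius_sum_rootMultiplicity`). Zeros with a_(m-1) = 0 cancel completely
(`misiurewiczOrder_of_eq_zero`). -/

noncomputable section

namespace Misiurewicz

/-! ### Möbius inversion of a function with jumps -/

/-- If `φ` jumps along a set `T` and is otherwise constant from the largest proper divisor in `T`,
then its Möbius transform is positive on `T` and zero off `T`. -/
theorem moebius_sum_of_jumps (φ : ℕ → ℤ) (T : Set ℕ)
    (h : ∀ n, 0 < n →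
      (∃ c, c ∣ n ∧ 0 < c ∧ c < n ∧ (∀ M ∈ T, M ∣ n → M ≠ n → M ∣ c) ∧
        (n ∈ T → φ c < φ n) ∧ (n ∉ T → φ c = φ n)) ∨
      ((∀ M ∈ T, M ∣ n → M = n) ∧ (n ∈ T → 0 < φ n) ∧ (n ∉ T → φ n = 0)))
    (n : ℕ) (hn : 0 < n) :
    (n ∈ T → 0 < ∑ k ∈ n.divisors, ArithmeticFunction.moebius (n / k) * φ k) ∧
    (n ∉ T → ∑ k ∈ n.divisors, ArithmeticFunction.moebius (n / k) * φ k = 0) := by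
  set δ : ℕ → ℤ := fun n => ∑ k ∈ n.divisors, ArithmeticFunction.moebius (n / k) * φ k with hδ
  have hsum : ∀ n > 0, ∑ k ∈ n.divisors, δ k = φ n := by
    refine ArithmeticFunction.sum_eq_iff_sum_mul_moebius_eq.2 fun n _ => ?_
    simpa only [Int.cast_id] using
      Nat.sum_divisorsAntidiagonal' fun a b => (ArithmeticFunction.moebius a : ℤ) * φ b
  change (n ∈ T → 0 < δ n) ∧ (n ∉ T → δ n = 0)
  induction n using Nat.strong_induction_on with
  | _ n ih =>
    have hprop : ∑ k ∈ n.properDivisors, δ k + δ n = φ n := by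
      rw [← hsum n hn, ← Nat.cons_self_properDivisors hn.ne', Finset.sum_cons, add_comm]
    rcases h n hn with ⟨c, hcn, hc0, hclt, hT, h1, h2⟩ | ⟨hT, h1, h2⟩
    -- By induction `δ` lives on `T`, and proper divisors of `n` in `T` divide `c`; hence `δ n = φ n
    -- - φ c`.
    · have hc : ∑ k ∈ n.properDivisors, δ k = φ c := by
        rw [← hsum c hc0]
        symm
        apply Finset.sum_subset
        · intro k hk
          rw [Nat.mem_divisors] at hk
          rw [Nat.mem_properDivisors]
          exact ⟨hk.1.trans hcn, (Nat.le_of_dvd hc0 hk.1).trans_lt hclt⟩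
        · intro k hk hk'
          rw [Nat.mem_properDivisors] at hk
          refine (ih k hk.2 (Nat.pos_of_dvd_of_pos hk.1 hn)).2 fun hkT => hk' ?_
          rw [Nat.mem_divisors]
          exact ⟨hT k hkT hk.1 hk.2.ne, hc0.ne'⟩
      rw [hc] at hprop
      exact ⟨fun hn => by linarith [h1 hn], fun hn => by linarith [h2 hn]⟩
    · have hc : ∑ k ∈ n.properDivisors, δ k = 0 := by
        refine Finset.sum_eq_zero fun k hk => ?_
        rw [Nat.mem_properDivisors] at hk
        exact (ih k hk.2 (Nat.pos_of_dvd_of_pos hk.1 hn)).2 fun hkT => hk.2.ne (hT k hkT hk.1)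
      rw [hc] at hprop
      exact ⟨fun hn => by linarith [h1 hn], fun hn => by linarith [h2 hn]⟩

/-! ### Roots of cyclotomic polynomials in any characteristic -/

/-- In characteristic p, Φ_(r p^i) with p ∤ r has the same roots as Φ_r. The exponential
characteristic 1 covers characteristic zero in the same formula. -/
theorem isRoot_cyclotomic_iff_exists_expChar {F : Type*} [Field F] (p : ℕ) [hp : ExpChar F p]
    (x : F) {s : ℕ} (hs : 0 < s) :
    (cyclotomic s F).IsRoot x ↔ ∃ r i, IsPrimitiveRoot x r ∧ s = r * p ^ i := by
  rcases hp with _ | hprime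
  · have : NeZero (s : F) := ⟨by exact_mod_cast hs.ne'⟩
    rw [isRoot_cyclotomic_iff]
    simp
  · have : Fact p.Prime := ⟨hprime⟩
    obtain ⟨i, r, hr, hsr⟩ := Nat.exists_eq_pow_mul_and_not_dvd hs.ne' p hprime.ne_one
    have : NeZero (r : F) := ⟨fun h => hr ((CharP.cast_eq_zero_iff F p r).1 h)⟩
    rw [hsr, isRoot_cyclotomic_prime_pow_mul_iff_of_charP]
    constructor
    · exact fun h => ⟨r, i, h, mul_comm _ _⟩
    · rintro ⟨r', i', h', he⟩
      have hr' : ¬ p ∣ r' := by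
        intro hdvd
        have : NeZero r' := ⟨by rintro rfl; simp at he; exact hs.ne' (by rw [hsr]; simpa using he)⟩
        have := h'.neZero' (n := r')
        exact this.1 ((CharP.cast_eq_zero_iff F p r').2 hdvd)
      have : r = r' := by
        rw [mul_comm r'] at he
        have c1 : Nat.Coprime r (p ^ i') := ((hprime.coprime_iff_not_dvd.2 hr).pow_left _).symm
        have c2 : Nat.Coprime r' (p ^ i) := ((hprime.coprime_iff_not_dvd.2 hr').pow_left _).symm
        exact Nat.dvd_antisymm (c1.dvd_of_dvd_mul_left (he ▸ Dvd.intro_left _ rfl))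
          (c2.dvd_of_dvd_mul_left (he ▸ Dvd.intro_left _ rfl))
      rwa [this]

/-- The indices `s` at which the order of vanishing of `f^[N * s] y - y` jumps, when `λ` is the
multiplier of the cycle of exact period `N`. -/
def jumpSet {F : Type*} [Field F] (x : F) : Set ℕ :=
  {s | s = 1 ∨ 2 ≤ s ∧ (cyclotomic s F).IsRoot x}

section jumpSet

variable {F : Type*} [Field F] {x : F}

theorem pos_of_mem_jumpSet {s : ℕ} (hs : s ∈ jumpSet x) : 0 < s := by
  rcases hs with rfl | ⟨h, _⟩ <;> omega

/-- Elements other than 1 have the form r p^i with r the fixed order of `x`, so they form a chain.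
This makes the largest jump below an index a multiple of all the others. -/
theorem dvd_or_dvd_of_mem_jumpSet {s t : ℕ} (hs : s ∈ jumpSet x) (ht : t ∈ jumpSet x) :
    s ∣ t ∨ t ∣ s := by
  rcases hs with rfl | ⟨hs2, hs⟩
  · simp
  rcases ht with rfl | ⟨ht2, ht⟩
  · simp
  obtain ⟨p, _⟩ := ExpChar.exists F
  rw [isRoot_cyclotomic_iff_exists_expChar p x (by omega)] at hs ht
  obtain ⟨r, i, hr, rfl⟩ := hs
  obtain ⟨r', j, hr', rfl⟩ := ht
  obtain rfl := hr.unique hr'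
  rcases le_total i j with h | h
  · exact Or.inl (mul_dvd_mul_left _ (pow_dvd_pow _ h))
  · exact Or.inr (mul_dvd_mul_left _ (pow_dvd_pow _ h))

theorem isRoot_cyclotomic_one_iff (p : ℕ) [ExpChar F p] {s : ℕ} (hs : 0 < s) :
    (cyclotomic s F).IsRoot (1 : F) ↔ ∃ i, s = p ^ i := by
  rw [isRoot_cyclotomic_iff_exists_expChar p 1 hs]
  constructor
  · rintro ⟨r, i, hr, rfl⟩
    obtain rfl := hr.unique IsPrimitiveRoot.one
    exact ⟨i, by simp⟩
  · rintro ⟨i, rfl⟩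
    exact ⟨1, i, IsPrimitiveRoot.one, by simp⟩

/-- Passing from a return map to its `s`-th iterate replaces `x` by `x ^ s`. For s = r p^i ≥ 2 this
power is 1, and Φ_t(1) = 0 only for t a power of p. -/
theorem mul_mem_jumpSet_iff {s t : ℕ} (hs : s ∈ jumpSet x) (ht : 2 ≤ t) :
    s * t ∈ jumpSet x ↔ (cyclotomic t F).IsRoot (x ^ s) := by
  have hst : 2 ≤ s * t := ht.trans (Nat.le_mul_of_pos_left _ (pos_of_mem_jumpSet hs))
  have hmem : s * t ∈ jumpSet x ↔ (cyclotomic (s * t) F).IsRoot x := by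
    constructor
    · rintro (h | h)
      · omega
      · exact h.2
    · exact fun h => Or.inr ⟨hst, h⟩
  rw [hmem]
  rcases hs with rfl | ⟨hs2, hs⟩
  · simp
  obtain ⟨p, _⟩ := ExpChar.exists F
  rw [isRoot_cyclotomic_iff_exists_expChar p x (by omega)] at hs ⊢
  obtain ⟨r, i, hr, rfl⟩ := hs
  rw [pow_mul, hr.pow_eq_one, one_pow, isRoot_cyclotomic_one_iff p (by omega)]
  have hr0 : 0 < r := Nat.pos_of_ne_zero (by rintro rfl; simp at hs2)
  have hp0 : 0 < p := expChar_pos F p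
  constructor
  · rintro ⟨r', j, hr', h⟩
    obtain rfl := hr.unique hr'
    rw [mul_assoc, Nat.mul_right_inj hr0.ne'] at h
    have hp1 : p ≠ 1 := by rintro rfl; simp at h; omega
    have hp1 : 1 < p := by omega
    have hij : i ≤ j := (Nat.pow_dvd_pow_iff_le_right hp1).1 (h ▸ Dvd.intro _ rfl)
    obtain ⟨k, rfl⟩ := Nat.exists_eq_add_of_le hij
    rw [pow_add, Nat.mul_right_inj (pow_pos hp0 _).ne'] at h
    exact ⟨k, h⟩
  · rintro ⟨k, rfl⟩
    exact ⟨r, i + k, hr, by rw [pow_add, mul_assoc]⟩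

theorem geom_sum_eq_zero_iff {j : ℕ} (hj : 0 < j) :
    ∑ i ∈ Finset.range j, x ^ i = 0 ↔ ∃ s, 2 ≤ s ∧ s ∣ j ∧ (cyclotomic s F).IsRoot x := by
  have h := congrArg (eval x) (prod_cyclotomic_eq_geom_sum hj F)
  rw [eval_prod, eval_geom_sum] at h
  rw [← h, Finset.prod_eq_zero_iff]
  constructor
  · rintro ⟨s, hs, h⟩
    rw [Finset.mem_erase, Nat.mem_divisors] at hs
    have := Nat.pos_of_dvd_of_pos hs.2.1 hj
    exact ⟨s, by omega, hs.2.1, h⟩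
  · rintro ⟨s, hs, hd, h⟩
    exact ⟨s, by simp; exact ⟨by omega, hd, by omega⟩, h⟩

end jumpSet

/-! ### Iterates of z^d + c and their multipliers -/

section iterate

variable {R : Type*} [CommRing R]

/-- The derivative of the `k`-th iterate of `z ^ d + c` at `y`. -/
def iterDeriv (d : ℕ) (c y : R) (k : ℕ) : R :=
  ∏ i ∈ Finset.range k, (d : R) * ((fun z : R => z ^ d + c)^[i] y) ^ (d - 1)

/-- A first-order Taylor expansion without division, hence usable over polynomial rings in any
characteristic. -/
theorem iterate_add_expansion (d : ℕ) (c y h : R) (k : ℕ) :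
    ∃ w, (fun z : R => z ^ d + c)^[k] (y + h) =
      (fun z : R => z ^ d + c)^[k] y + iterDeriv d c y k * h + w * h ^ 2 := by
  induction k with
  | zero => exact ⟨0, by simp [iterDeriv]⟩
  | succ k ih =>
    obtain ⟨w, hw⟩ := ih
    set u := (fun z : R => z ^ d + c)^[k] y with hu
    obtain ⟨v, hv⟩ := powAddExpansion u (iterDeriv d c y k * h + w * h ^ 2) d
    refine ⟨d * u ^ (d - 1) * w + v * (iterDeriv d c y k + w * h) ^ 2, ?_⟩
    rw [Function.iterate_succ_apply', Function.iterate_succ_apply', hw, ← hu, add_assoc u, hv]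
    rw [iterDeriv, iterDeriv, Finset.prod_range_succ, ← hu]
    ring

/-- Iterating a return map: `f^[N * j] y - y` is a multiple of `f^[N] y - y`, and the cofactor is
a geometric sum in the multiplier, up to a multiple of `f^[N] y - y`. -/
theorem iterate_mul_sub_self (d : ℕ) (c y : R) (N j : ℕ) :
    ∃ e w, (fun z : R => z ^ d + c)^[N * j] y - y = ((fun z : R => z ^ d + c)^[N] y - y) * e ∧
      e = ∑ i ∈ Finset.range j, iterDeriv d c y N ^ i +
        w * ((fun z : R => z ^ d + c)^[N] y - y) := by
  set b := (fun z : R => z ^ d + c)^[N] y - y with hb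
  induction j with
  | zero => exact ⟨0, 0, by simp, by simp⟩
  | succ j ih =>
    obtain ⟨e, w, h1, h2⟩ := ih
    -- The point after `N * j` steps is `y + b * e`; expanding one more return there gives the
    -- recursion e ↦ 1 + λe + κbe².
    obtain ⟨κ, hκ⟩ := iterate_add_expansion d c y (b * e) N
    refine ⟨1 + iterDeriv d c y N * e + κ * b * e ^ 2, iterDeriv d c y N * w + κ * e ^ 2, ?_, ?_⟩
    · rw [Nat.mul_succ, Nat.add_comm, Function.iterate_add_apply, sub_eq_iff_eq_add'.1 h1, hκ,
        sub_eq_iff_eq_add'.1 hb.symm]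
      ring
    · rw [Finset.sum_range_succ', h2]
      simp only [pow_succ, ← Finset.sum_mul, pow_zero]
      ring

theorem map_iterate {S : Type*} [CommRing S] (π : R →+* S) (d : ℕ) (c y : R) (k : ℕ) :
    π ((fun z : R => z ^ d + c)^[k] y) = (fun z : S => z ^ d + π c)^[k] (π y) := by
  induction k with
  | zero => rfl
  | succ k ih => simp [Function.iterate_succ_apply', ih]

theorem map_iterDeriv {S : Type*} [CommRing S] (π : R →+* S) (d : ℕ) (c y : R) (k : ℕ) :
    π (iterDeriv d c y k) = iterDeriv d (π c) (π y) k := by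
  simp [iterDeriv, map_iterate]

theorem iterDeriv_mul_of_isPeriodicPt (d : ℕ) (c y : R) {N : ℕ}
    (h : Function.IsPeriodicPt (fun z : R => z ^ d + c) N y) (j : ℕ) :
    iterDeriv d c y (N * j) = iterDeriv d c y N ^ j := by
  induction j with
  | zero => simp [iterDeriv]
  | succ j ih =>
    rw [pow_succ, ← ih, iterDeriv, iterDeriv, iterDeriv, Nat.mul_succ, Finset.prod_range_add]
    congr 1
    refine Finset.prod_congr rfl fun i _ => ?_
    rw [Nat.add_comm, Function.iterate_add_apply, (h.mul_const j).eq]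

end iterate

/-! ### Vanishing orders of dynatomic products -/

section orders

variable {F : Type*} [Field F]

/-- The multiplier of the cycle of `z ^ d + c` through `y`, read off at the minimal period. -/
def cycleMultiplier (d : ℕ) (c y : F) : F :=
  iterDeriv d c y (Function.minimalPeriod (fun z : F => z ^ d + c) y)

/-- The periods `n` at which the dynatomic polynomial of `z ^ d + c` vanishes at `y`. -/
def dynatomicPeriods (d : ℕ) (c y : F) : Set ℕ :=
  {n | 0 < n ∧ ∃ s ∈ jumpSet (cycleMultiplier d c y),
    n = Function.minimalPeriod (fun z : F => z ^ d + c) y * s}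

theorem eval_iterate_sub_self (d : ℕ) (α : F) (y : F[X]) (k : ℕ) :
    eval α ((fun z : F[X] => z ^ d + X)^[k] y - y) =
      (fun z : F => z ^ d + α)^[k] (eval α y) - eval α y := by
  have := map_iterate (evalRingHom α) d X y k
  simp only [coe_evalRingHom, eval_X] at this
  rw [eval_sub, this]

theorem eval_iterate_sub_self_eq_zero_iff (d : ℕ) (α : F) (y : F[X]) (k : ℕ) :
    eval α ((fun z : F[X] => z ^ d + X)^[k] y - y) = 0 ↔
      Function.minimalPeriod (fun z : F => z ^ d + α) (eval α y) ∣ k := by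
  rw [eval_iterate_sub_self, sub_eq_zero]
  exact Function.isPeriodicPt_iff_minimalPeriod_dvd

/-- The quotient of the two differences is the cofactor `e` of `iterate_mul_sub_self`, whose value
at `α` is the geometric sum. The order jumps exactly when this value is zero. -/
theorem rootMultiplicity_iterate_mul (d : ℕ) (α : F) (y : F[X]) {N s t : ℕ}
    (hN : N = Function.minimalPeriod (fun z : F => z ^ d + α) (eval α y))
    (hne : (fun z : F[X] => z ^ d + X)^[N * s * t] y - y ≠ 0) :
    ((fun z : F[X] => z ^ d + X)^[N * s] y - y).rootMultiplicity α ≤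
        ((fun z : F[X] => z ^ d + X)^[N * s * t] y - y).rootMultiplicity α ∧
    (((fun z : F[X] => z ^ d + X)^[N * s] y - y).rootMultiplicity α =
        ((fun z : F[X] => z ^ d + X)^[N * s * t] y - y).rootMultiplicity α ↔
      ∑ i ∈ Finset.range t, (cycleMultiplier d α (eval α y) ^ s) ^ i ≠ 0) := by
  obtain ⟨e, w, h1, h2⟩ := iterate_mul_sub_self d X y (N * s) t
  have hne' := hne
  rw [h1] at hne' ⊢
  have he : e ≠ 0 := right_ne_zero_of_mul hne'
  have hev : eval α e = ∑ i ∈ Finset.range t, (cycleMultiplier d α (eval α y) ^ s) ^ i := by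
    have hper : Function.IsPeriodicPt (fun z : F => z ^ d + α) N (eval α y) :=
      hN ▸ Function.isPeriodicPt_minimalPeriod _ _
    have h0 : eval α ((fun z : F[X] => z ^ d + X)^[N * s] y - y) = 0 := by
      rw [eval_iterate_sub_self_eq_zero_iff, ← hN]
      exact Dvd.intro _ rfl
    have hd := map_iterDeriv (evalRingHom α) d X y (N * s)
    simp only [coe_evalRingHom, eval_X] at hd
    rw [h2, eval_add, eval_mul, h0, mul_zero, add_zero, eval_finsetSum]
    refine Finset.sum_congr rfl fun i _ => ?_
    rw [eval_pow, hd, iterDeriv_mul_of_isPeriodicPt d α _ hper, cycleMultiplier, ← hN]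
  rw [rootMultiplicity_mul hne', ← hev]
  refine ⟨Nat.le_add_right _ _, ?_⟩
  rw [left_eq_add, ← not_iff_not, not_not, ← ne_eq, ← Nat.pos_iff_ne_zero,
    rootMultiplicity_pos he]
  rfl

/-- The order at `α` of the dynatomic product `∏_{k ∣ n} (f^[k] y - y) ^ μ(n/k)`. -/
theorem moebius_sum_rootMultiplicity (d : ℕ) (α : F) (y : F[X])
    (hne : ∀ k, 0 < k → (fun z : F[X] => z ^ d + X)^[k] y - y ≠ 0) (n : ℕ) (hn : 0 < n) :
    (n ∈ dynatomicPeriods d α (eval α y) →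
      0 < ∑ k ∈ n.divisors, ArithmeticFunction.moebius (n / k) *
        (((fun z : F[X] => z ^ d + X)^[k] y - y).rootMultiplicity α : ℤ)) ∧
    (n ∉ dynatomicPeriods d α (eval α y) →
      ∑ k ∈ n.divisors, ArithmeticFunction.moebius (n / k) *
        (((fun z : F[X] => z ^ d + X)^[k] y - y).rootMultiplicity α : ℤ) = 0) := by
  refine moebius_sum_of_jumps
    (fun k => (((fun z : F[X] => z ^ d + X)^[k] y - y).rootMultiplicity α : ℤ))
    (dynatomicPeriods d α (eval α y)) (fun n hn => ?_) n hn
  obtain ⟨N, hN⟩ : ∃ N, N = Function.minimalPeriod (fun z : F => z ^ d + α) (eval α y) := ⟨_, rfl⟩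
  have hpos : ∀ k, 0 < k →
      (0 < ((fun z : F[X] => z ^ d + X)^[k] y - y).rootMultiplicity α ↔ N ∣ k) := fun k hk => by
    rw [rootMultiplicity_pos (hne k hk), IsRoot, eval_iterate_sub_self_eq_zero_iff, hN]
  set x := cycleMultiplier d α (eval α y) with hx
  have hT : ∀ M, M ∈ dynatomicPeriods d α (eval α y) ↔ 0 < M ∧ ∃ s ∈ jumpSet x, M = N * s := by
    intro M
    rw [hN]
    rfl
  by_cases hNn : N ∣ n
  · obtain ⟨j, rfl⟩ := hNn
    have hN0 : 0 < N := pos_of_mul_pos_left hn (Nat.zero_le _)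
    have hj0 : 0 < j := pos_of_mul_pos_right hn (Nat.zero_le _)
    have hTj : N * j ∈ dynatomicPeriods d α (eval α y) ↔ j ∈ jumpSet x := by
      rw [hT]
      constructor
      · rintro ⟨_, s, hs, h⟩
        rwa [Nat.eq_of_mul_eq_mul_left hN0 h]
      · exact fun h => ⟨hn, j, h, rfl⟩
    rcases Nat.lt_or_ge 1 j with hj | hj
    · left
      classical
      -- The comparison index is `N * s`, for `s` the largest jump properly dividing `j`; the jump 1
      -- makes the set nonempty.
      obtain ⟨s, hs, hmax⟩ := (j.properDivisors.filter (· ∈ jumpSet x)).exists_max_image id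
        ⟨1, by simp [jumpSet, hj]⟩
      rw [Finset.mem_filter, Nat.mem_properDivisors] at hs
      obtain ⟨⟨⟨t, rfl⟩, hslt⟩, hsx⟩ := hs
      have hs0 := pos_of_mem_jumpSet hsx
      have ht : 2 ≤ t := by
        by_contra h
        interval_cases t <;> omega
      have key := rootMultiplicity_iterate_mul d α y (s := s) (t := t) hN
        (by rw [mul_assoc]; exact hne _ hn)
      rw [mul_assoc] at key
      refine ⟨N * s, ⟨t, by ring⟩, Nat.mul_pos hN0 hs0, Nat.mul_lt_mul_of_pos_left hslt hN0, ?_,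
        ?_, ?_⟩
      · intro M hM hMn hMne
        rw [hT] at hM
        obtain ⟨_, s', hs', rfl⟩ := hM
        have hdvd : s' ∣ s * t := Nat.dvd_of_mul_dvd_mul_left hN0 hMn
        have hne' : s' ≠ s * t := fun h => hMne (by rw [h])
        have hle : s' ≤ s := hmax s' (by
          rw [Finset.mem_filter, Nat.mem_properDivisors]
          exact ⟨⟨hdvd, lt_of_le_of_ne (Nat.le_of_dvd hj0 hdvd) hne'⟩, hs'⟩)
        refine mul_dvd_mul_left _ ?_
        rcases dvd_or_dvd_of_mem_jumpSet hs' hsx with h | h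
        · exact h
        · rw [le_antisymm hle (Nat.le_of_dvd (pos_of_mem_jumpSet hs') h)]
      · intro hmem
        rw [hTj, mul_mem_jumpSet_iff hsx ht] at hmem
        have h0 := (geom_sum_eq_zero_iff (x := x ^ s) (by omega : 0 < t)).2 ⟨t, ht, dvd_rfl, hmem⟩
        exact_mod_cast lt_of_le_of_ne key.1 fun h => key.2.1 h h0
      · intro hmem
        rw [hTj] at hmem
        refine congrArg Nat.cast (key.2.2 fun h0 => ?_)
        -- A vanishing sum yields a jump `s * r` dividing `j`, larger than `s`, and different from
        -- `j`, against maximality.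
        obtain ⟨r, hr, hrt, hroot⟩ := (geom_sum_eq_zero_iff (by omega : 0 < t)).1 h0
        have hsr := (mul_mem_jumpSet_iff hsx hr).2 hroot
        have hdvd : s * r ∣ s * t := mul_dvd_mul_left _ hrt
        have hne' : s * r ≠ s * t := fun h => hmem (h ▸ hsr)
        have hle : s * r ≤ s := hmax (s * r) (by
          rw [Finset.mem_filter, Nat.mem_properDivisors]
          exact ⟨⟨hdvd, lt_of_le_of_ne (Nat.le_of_dvd hj0 hdvd) hne'⟩, hsr⟩)
        nlinarith
    · right
      obtain rfl : j = 1 := by omega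
      refine ⟨?_, fun _ => ?_, fun h => ?_⟩
      · intro M hM hMn
        rw [hT] at hM
        obtain ⟨_, s, hs, rfl⟩ := hM
        exact Nat.dvd_antisymm hMn (by simp)
      · exact_mod_cast (hpos _ hn).2 (by simp)
      · exact absurd (hTj.2 (Or.inl rfl)) h
  · right
    -- A non-periodic point has `N = 0`, which divides no positive `n`, so it falls under this case.
    have hnot : ∀ M ∈ dynatomicPeriods d α (eval α y), ¬ M ∣ n := by
      intro M hM hMn
      rw [hT] at hM
      obtain ⟨_, s, hs, rfl⟩ := hM
      exact hNn ((Dvd.intro _ rfl).trans hMn)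
    refine ⟨fun M hM hMn => absurd hMn (hnot M hM), fun h => absurd dvd_rfl (hnot n h), fun _ => ?_⟩
    have := (hpos n hn).not.2 hNn
    simp only [not_lt, nonpos_iff_eq_zero] at this
    exact_mod_cast this

/-- If the `s`-th cyclotomic polynomial vanishes at the multiplier of the `ℓ`-cycle, then `ℓ * s` is
again a period at which the dynatomic polynomial vanishes. -/
theorem mul_mem_dynatomicPeriods (d : ℕ) (c y : F) {ℓ s : ℕ}
    (hℓ : ℓ ∈ dynatomicPeriods d c y) (hs : 2 ≤ s)
    (hroot : (cyclotomic s F).IsRoot (iterDeriv d c y ℓ)) : ℓ * s ∈ dynatomicPeriods d c y := by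
  obtain ⟨h0, t, ht, rfl⟩ := hℓ
  rw [iterDeriv_mul_of_isPeriodicPt d c y (Function.isPeriodicPt_minimalPeriod _ _)] at hroot
  exact ⟨Nat.mul_pos h0 (by omega), t * s, (mul_mem_jumpSet_iff ht hs).2 hroot, mul_assoc _ _ _⟩

theorem isPeriodicPt_of_mem_dynatomicPeriods {d : ℕ} {c y : F} {n : ℕ}
    (h : n ∈ dynatomicPeriods d c y) : Function.IsPeriodicPt (fun z : F => z ^ d + c) n y := by
  obtain ⟨_, s, _, rfl⟩ := h
  exact (Function.isPeriodicPt_minimalPeriod _ _).mul_const s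

end orders

/-! ### The critical orbit as polynomials in the parameter -/

section critOrbit

variable {R : Type*} [CommRing R]

theorem map_critOrbit {S : Type*} [CommRing S] (φ : R →+* S) (d i : ℕ) :
    (critOrbit R d i).map φ = critOrbit S d i := by
  induction i with
  | zero => simp [critOrbit]
  | succ i ih => simp [critOrbit, ih]

theorem critOrbit_add (d i k : ℕ) :
    critOrbit R d (i + k) = (fun z : R[X] => z ^ d + X)^[k] (critOrbit R d i) := by
  induction k with
  | zero => rfl
  | succ k ih => rw [Function.iterate_succ_apply', ← ih]; rfl

theorem critOrbit_eq_iterate (d k : ℕ) :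
    critOrbit R d k = (fun z : R[X] => z ^ d + X)^[k] 0 := by
  have := critOrbit_add (R := R) d 0 k
  rwa [zero_add] at this

theorem eval_critOrbit_add (d i k : ℕ) (α : R) :
    (critOrbit R d (i + k)).eval α =
      (fun z : R => z ^ d + α)^[k] ((critOrbit R d i).eval α) := by
  have := map_iterate (evalRingHom α) d X (critOrbit R d i) k
  rw [← critOrbit_add] at this
  simpa using this

theorem critOrbit_succ_monic_natDegree [Nontrivial R] {d : ℕ} (hd : 2 ≤ d) (i : ℕ) :
    (critOrbit R d (i + 1)).Monic ∧ (critOrbit R d (i + 1)).natDegree = d ^ i := by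
  induction i with
  | zero => simp [critOrbit, zero_pow (by omega : d ≠ 0), monic_X]
  | succ i ih =>
    have hlt : (X : R[X]).degree < (critOrbit R d (i + 1) ^ d).degree := by
      rw [degree_eq_natDegree (ih.1.pow d).ne_zero, ih.1.natDegree_pow, ih.2, degree_X]
      have : 1 ≤ d ^ i := Nat.one_le_pow _ _ (by omega)
      exact_mod_cast (by nlinarith : 1 < d * d ^ i)
    rw [critOrbit]
    refine ⟨(ih.1.pow d).add_of_left hlt, ?_⟩
    rw [natDegree_add_eq_left_of_degree_lt hlt, ih.1.natDegree_pow, ih.2, pow_succ, mul_comm]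

theorem critOrbit_monic [Nontrivial R] {d : ℕ} (hd : 2 ≤ d) {i : ℕ} (hi : 0 < i) :
    (critOrbit R d i).Monic := by
  obtain ⟨j, rfl⟩ := Nat.exists_eq_succ_of_ne_zero hi.ne'
  exact (critOrbit_succ_monic_natDegree hd j).1

/-- The polynomial in the parameter whose roots are those with `a_(m+k-1) = ζ a_(m-1)`. -/
def preperiodicPoly (d m : ℕ) (ζ : R) (k : ℕ) : R[X] :=
  critOrbit R d (m + k - 1) - C ζ * critOrbit R d (m - 1)

theorem map_preperiodicPoly {S : Type*} [CommRing S] (φ : R →+* S) (d m : ℕ) (ζ : R) (k : ℕ) :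
    (preperiodicPoly d m ζ k).map φ = preperiodicPoly d m (φ ζ) k := by
  simp [preperiodicPoly, map_critOrbit]

/-- ζ a_(m-1) and a_(m-1) have the same `d`-th power, so their orbits merge after one step.
Preperiodicity of 0 thus becomes periodicity of ζ a_(m-1). -/
theorem preperiodicPoly_eq_iterate {d m : ℕ} (hm : 2 ≤ m) {ζ : R} (hζ : ζ ^ d = 1) {k : ℕ}
    (hk : 0 < k) :
    preperiodicPoly d m ζ k =
      (fun z : R[X] => z ^ d + X)^[k] (C ζ * critOrbit R d (m - 1)) -
        C ζ * critOrbit R d (m - 1) := by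
  obtain ⟨m, rfl⟩ := Nat.exists_eq_add_of_le' (by omega : 1 ≤ m)
  obtain ⟨k, rfl⟩ := Nat.exists_eq_add_of_le' hk
  rw [preperiodicPoly, Function.iterate_succ_apply, mul_pow, ← C_pow, hζ, C_1, one_mul,
    show m + 1 + (k + 1) - 1 = (m + 1) + k by omega, critOrbit_add]
  rfl

theorem preperiodicPoly_monic [Nontrivial R] {d m : ℕ} (hd : 2 ≤ d) (hm : 2 ≤ m) (ζ : R) {k : ℕ}
    (hk : 0 < k) : (preperiodicPoly d m ζ k).Monic := by
  obtain ⟨m, rfl⟩ := Nat.exists_eq_add_of_le' hm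
  obtain ⟨h1, h2⟩ := critOrbit_succ_monic_natDegree (R := R) hd (m + k)
  obtain ⟨h3, h4⟩ := critOrbit_succ_monic_natDegree (R := R) hd m
  rw [preperiodicPoly, show m + 2 + k - 1 = m + k + 1 by omega, show m + 2 - 1 = m + 1 by omega]
  refine h1.sub_of_left ?_
  rw [← smul_eq_C_mul]
  refine (degree_smul_le _ _).trans_lt ?_
  rw [degree_eq_natDegree h1.ne_zero, degree_eq_natDegree h3.ne_zero, h2, h4]
  exact_mod_cast Nat.pow_lt_pow_right (by omega) (by omega)

end critOrbit

/-! ### Möbius products of monic polynomials -/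

section moebiusProd

variable {R : Type*} [CommRing R]

/-- The product of the `g k`, `k ∣ n`, with `μ (n / k) = ε`, for `ε = 1` or `ε = -1`. -/
def moebiusProd (ε : ℤ) (g : ℕ → R[X]) (n : ℕ) : R[X] :=
  ∏ k ∈ n.divisors, g k ^ (ε * ArithmeticFunction.moebius (n / k)).toNat

theorem map_moebiusProd {S : Type*} [CommRing S] (φ : R →+* S) (ε : ℤ) (g : ℕ → R[X]) (n : ℕ) :
    (moebiusProd ε g n).map φ = moebiusProd ε (fun k => (g k).map φ) n := by
  simp [moebiusProd, Polynomial.map_prod]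

theorem moebiusProd_monic (ε : ℤ) {g : ℕ → R[X]} (hg : ∀ k, 0 < k → (g k).Monic) (n : ℕ) :
    (moebiusProd ε g n).Monic :=
  monic_prod_of_monic _ _ fun k hk => (hg k (Nat.pos_of_mem_divisors hk)).pow _

/-- The product of the factors of `misiurewiczRat` that occur with exponent `1` (for `ε = 1`),
respectively `-1` (for `ε = -1`). -/
def misiurewiczProd (ε : ℤ) (d m n : ℕ) (ζ : R) : R[X] :=
  moebiusProd ε (preperiodicPoly d m ζ) n *
    if n ∣ m - 1 then moebiusProd (-ε) (critOrbit R d) n else 1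

theorem map_misiurewiczProd {S : Type*} [CommRing S] (φ : R →+* S) (ε : ℤ) (d m n : ℕ) (ζ : R) :
    (misiurewiczProd ε d m n ζ).map φ = misiurewiczProd ε d m n (φ ζ) := by
  unfold misiurewiczProd
  split_ifs <;> simp [map_moebiusProd, map_preperiodicPoly, map_critOrbit]

theorem misiurewiczProd_monic [Nontrivial R] (ε : ℤ) {d m : ℕ} (hd : 2 ≤ d) (hm : 2 ≤ m) (n : ℕ)
    (ζ : R) : (misiurewiczProd ε d m n ζ).Monic := by
  have h1 := moebiusProd_monic ε (fun k hk => preperiodicPoly_monic hd hm ζ hk) n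
  unfold misiurewiczProd
  split_ifs
  · exact h1.mul (moebiusProd_monic _ (fun k hk => critOrbit_monic hd hk) n)
  · simpa using h1

end moebiusProd

/-! ### The order of the Misiurewicz rational function at a parameter -/

section field

variable {F : Type*} [Field F]

theorem zpow_eq_toNat_div {K : Type*} [Field K] {x : K} (hx : x ≠ 0) (z : ℤ) :
    x ^ z = x ^ z.toNat / x ^ (-z).toNat := by
  rw [← zpow_natCast, ← zpow_natCast, ← zpow_sub₀ hx, Int.toNat_sub_toNat_neg]

theorem prod_zpow_eq_moebiusProd_div {g : ℕ → F[X]} (hg : ∀ k, 0 < k → (g k).Monic) (n : ℕ) :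
    ∏ k ∈ n.divisors, algebraMap F[X] (RatFunc F) (g k) ^ (ArithmeticFunction.moebius (n / k)) =
      algebraMap F[X] (RatFunc F) (moebiusProd 1 g n) /
        algebraMap F[X] (RatFunc F) (moebiusProd (-1) g n) := by
  rw [moebiusProd, moebiusProd, map_prod, map_prod, ← Finset.prod_div_distrib]
  refine Finset.prod_congr rfl fun k hk => ?_
  have : algebraMap F[X] (RatFunc F) (g k) ≠ 0 :=
    RatFunc.algebraMap_ne_zero (hg k (Nat.pos_of_mem_divisors hk)).ne_zero
  rw [zpow_eq_toNat_div this, map_pow, map_pow, one_mul, neg_one_mul]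

theorem misiurewiczRat_eq_div {d m : ℕ} (hd : 2 ≤ d) (hm : 2 ≤ m) (n : ℕ) (ζ : F) :
    misiurewiczRat d m n ζ = algebraMap F[X] (RatFunc F) (misiurewiczProd 1 d m n ζ) /
      algebraMap F[X] (RatFunc F) (misiurewiczProd (-1) d m n ζ) := by
  have h1 := prod_zpow_eq_moebiusProd_div (fun k hk => preperiodicPoly_monic hd hm ζ hk) n
  have h2 := prod_zpow_eq_moebiusProd_div (F := F) (fun k hk => critOrbit_monic hd hk) n
  unfold preperiodicPoly at h1
  rw [misiurewiczRat, misiurewiczProd, misiurewiczProd, h1]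
  split_ifs
  · simp_rw [zpow_neg]
    rw [Finset.prod_inv_distrib, h2, map_mul, map_mul, neg_neg, inv_div, div_mul_div_comm]
    rfl
  · simp only [mul_one]
    rfl

theorem num_mul_misiurewiczProd {d m : ℕ} (hd : 2 ≤ d) (hm : 2 ≤ m) (n : ℕ) (ζ : F) :
    (misiurewiczRat d m n ζ).num * misiurewiczProd (-1) d m n ζ =
      misiurewiczProd 1 d m n ζ * (misiurewiczRat d m n ζ).denom := by
  rw [RatFunc.num_mul_eq_mul_denom_iff (misiurewiczProd_monic _ hd hm n ζ).ne_zero]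
  exact misiurewiczRat_eq_div hd hm n ζ

theorem rootMultiplicity_moebiusProd {g : ℕ → F[X]} (hg : ∀ k, 0 < k → (g k).Monic)
    (ε : ℤ) (n : ℕ) (α : F) :
    (moebiusProd ε g n).rootMultiplicity α =
      ∑ k ∈ n.divisors, (ε * ArithmeticFunction.moebius (n / k)).toNat *
        (g k).rootMultiplicity α := by
  classical
  have hne : moebiusProd ε g n ≠ 0 := (moebiusProd_monic ε hg n).ne_zero
  rw [← count_roots, moebiusProd, roots_prod _ _ hne, Multiset.count_bind, Finset.sum_map_val]
  refine Finset.sum_congr rfl fun k _ => ?_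
  rw [roots_pow, Multiset.count_nsmul, count_roots]

theorem rootMultiplicity_moebiusProd_sub {g : ℕ → F[X]} (hg : ∀ k, 0 < k → (g k).Monic)
    (n : ℕ) (α : F) :
    ((moebiusProd 1 g n).rootMultiplicity α : ℤ) - (moebiusProd (-1) g n).rootMultiplicity α =
      ∑ k ∈ n.divisors, ArithmeticFunction.moebius (n / k) * ((g k).rootMultiplicity α : ℤ) := by
  rw [rootMultiplicity_moebiusProd hg, rootMultiplicity_moebiusProd hg]
  push_cast
  rw [← Finset.sum_sub_distrib]
  refine Finset.sum_congr rfl fun k _ => ?_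
  rw [← sub_mul]
  congr 1
  omega

/-- The order at `α` of `misiurewiczRat`. -/
def misiurewiczOrder (d m n : ℕ) (ζ α : F) : ℤ :=
  (misiurewiczProd 1 d m n ζ).rootMultiplicity α - (misiurewiczProd (-1) d m n ζ).rootMultiplicity α

theorem misiurewiczOrder_eq {d m : ℕ} (hd : 2 ≤ d) (hm : 2 ≤ m) (n : ℕ) (ζ α : F) :
    misiurewiczOrder d m n ζ α =
      ∑ k ∈ n.divisors, ArithmeticFunction.moebius (n / k) *
        ((preperiodicPoly d m ζ k).rootMultiplicity α : ℤ) -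
      if n ∣ m - 1 then ∑ k ∈ n.divisors, ArithmeticFunction.moebius (n / k) *
        ((critOrbit F d k).rootMultiplicity α : ℤ) else 0 := by
  have hp := fun k (hk : 0 < k) => preperiodicPoly_monic hd hm ζ hk
  have hc := fun k (hk : 0 < k) => critOrbit_monic (R := F) hd hk
  rw [← rootMultiplicity_moebiusProd_sub hp, ← rootMultiplicity_moebiusProd_sub hc,
    misiurewiczOrder, misiurewiczProd, misiurewiczProd]
  split_ifs
  · rw [rootMultiplicity_mul ((moebiusProd_monic _ hp n).mul (moebiusProd_monic _ hc n)).ne_zero,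
      rootMultiplicity_mul ((moebiusProd_monic _ hp n).mul (moebiusProd_monic _ hc n)).ne_zero]
    push_cast
    ring
  · simp

/-- Away from the roots of `a_(m-1)`, the order is that of the dynatomic product at
`y = ζ a_(m-1)`. -/
theorem misiurewiczOrder_of_ne_zero {d m n : ℕ} (hd : 2 ≤ d) (hm : 2 ≤ m) (hn : 0 < n) {ζ α : F}
    (hζ : ζ ^ d = 1) (h0 : (critOrbit F d (m - 1)).eval α ≠ 0) :
    (n ∈ dynatomicPeriods d α (ζ * (critOrbit F d (m - 1)).eval α) →
      0 < misiurewiczOrder d m n ζ α) ∧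
    (n ∉ dynatomicPeriods d α (ζ * (critOrbit F d (m - 1)).eval α) →
      misiurewiczOrder d m n ζ α = 0) := by
  have key := moebius_sum_rootMultiplicity d α (C ζ * critOrbit F d (m - 1)) (fun k hk => by
    rw [← preperiodicPoly_eq_iterate hm hζ hk]
    exact (preperiodicPoly_monic hd hm ζ hk).ne_zero) n hn
  rw [eval_mul, eval_C] at key
  have hsum : misiurewiczOrder d m n ζ α = ∑ k ∈ n.divisors, ArithmeticFunction.moebius (n / k) *
        (((fun z : F[X] => z ^ d + X)^[k] (C ζ * critOrbit F d (m - 1)) -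
          C ζ * critOrbit F d (m - 1)).rootMultiplicity α : ℤ) := by
    rw [misiurewiczOrder_eq hd hm]
    have h2 : (if n ∣ m - 1 then ∑ k ∈ n.divisors, ArithmeticFunction.moebius (n / k) *
        ((critOrbit F d k).rootMultiplicity α : ℤ) else 0) = 0 := by
      split_ifs with hnm
      · refine Finset.sum_eq_zero fun k hk => ?_
        obtain ⟨j, hj⟩ := (Nat.dvd_of_mem_divisors hk).trans hnm
        -- A zero of a_k with k ∣ m - 1 gives 0 the period k, forcing a_(m-1) to vanish too.
        have : ¬ (critOrbit F d k).IsRoot α := by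
          intro hroot
          apply h0
          have hper : Function.IsPeriodicPt (fun z : F => z ^ d + α) k 0 := by
            have := eval_critOrbit_add d 0 k α
            rw [zero_add, hroot.eq_zero] at this
            simpa [critOrbit, Function.IsPeriodicPt, Function.IsFixedPt] using this.symm
          have h3 := eval_critOrbit_add d 0 (m - 1) α
          rw [zero_add] at h3
          rw [h3, hj]
          simpa [critOrbit] using (hper.mul_const j).eq
        rw [rootMultiplicity_eq_zero this]
        simp
      · rfl
    rw [h2, sub_zero]
    refine Finset.sum_congr rfl fun k hk => ?_
    rw [preperiodicPoly_eq_iterate hm hζ (Nat.pos_of_mem_divisors hk)]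
  rw [hsum]
  exact key

end field

section field

variable {F : Type*} [Field F]

/-- Φ_s(0) = 1 for s ≥ 2, so a superattracting cycle has only the jump s = 1. -/
theorem eq_minimalPeriod_of_cycleMultiplier_eq_zero {d : ℕ} {c y : F} (h : cycleMultiplier d c y = 0)
    {n : ℕ} (hn : n ∈ dynatomicPeriods d c y) :
    n = Function.minimalPeriod (fun z : F => z ^ d + c) y := by
  obtain ⟨_, s, hs | ⟨hs2, hs⟩, rfl⟩ := hn
  · rw [hs, mul_one]
  · rw [h, IsRoot, ← coeff_zero_eq_eval_zero, cyclotomic_coeff_zero _ (by omega)] at hs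
    exact absurd hs one_ne_zero

/-- 0 is a critical point, so iterates have no linear term there. -/
theorem sq_dvd_iterate_sub_iterate_zero {R : Type*} [CommRing R] {d : ℕ} (hd : 2 ≤ d) (c x : R)
    {k : ℕ} (hk : 0 < k) :
    x ^ 2 ∣ (fun z : R => z ^ d + c)^[k] x - (fun z : R => z ^ d + c)^[k] 0 := by
  obtain ⟨k, rfl⟩ := Nat.exists_eq_add_of_le' hk
  induction k with
  | zero =>
    simp only [zero_add, Function.iterate_one, zero_pow (by omega : d ≠ 0), add_sub_cancel_right]
    exact pow_dvd_pow _ hd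
  | succ k ih =>
    rw [Function.iterate_succ_apply', Function.iterate_succ_apply' _ _ 0, add_sub_add_right_eq_sub]
    exact (ih (by omega)).trans (sub_dvd_pow_sub_pow _ _ _)

/-- At a parameter where the critical point is periodic with `a_(m-1) = 0`, the zeros of the two
products in `misiurewiczRat` cancel. -/
theorem misiurewiczOrder_of_eq_zero {d m n : ℕ} (hd : 2 ≤ d) (hm : 2 ≤ m) (hn : 0 < n) {ζ α : F}
    (hζ1 : ζ ≠ 1) (h0 : (critOrbit F d (m - 1)).eval α = 0) :
    misiurewiczOrder d m n ζ α = 0 := by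
  obtain ⟨N, hN⟩ : ∃ N, N = Function.minimalPeriod (fun z : F => z ^ d + α) 0 := ⟨_, rfl⟩
  have heval : ∀ k, (critOrbit F d k).eval α = 0 ↔ N ∣ k := fun k => by
    have := eval_iterate_sub_self_eq_zero_iff d α 0 k
    rwa [sub_zero, ← critOrbit_eq_iterate, eval_zero, ← hN] at this
  have hNm : N ∣ m - 1 := (heval _).1 h0
  have hN0 : 0 < N := Nat.pos_of_dvd_of_pos hNm (by omega)
  have hcyc : cycleMultiplier d α (0 : F) = 0 := by
    rw [cycleMultiplier, ← hN, iterDeriv]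
    refine Finset.prod_eq_zero (Finset.mem_range.2 hN0) ?_
    simp [zero_pow (by omega : d - 1 ≠ 0)]
  have hmul : ∀ j, 0 < j → ∃ e : F[X], critOrbit F d (N * j) = critOrbit F d N * e ∧
      eval α e = 1 := by
    intro j hj
    obtain ⟨e, w, h1, h2⟩ := iterate_mul_sub_self d X (0 : F[X]) N j
    rw [sub_zero, sub_zero, ← critOrbit_eq_iterate, ← critOrbit_eq_iterate] at h1
    rw [sub_zero, ← critOrbit_eq_iterate] at h2
    refine ⟨e, h1, ?_⟩
    have hd := map_iterDeriv (evalRingHom α) d X 0 N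
    simp only [coe_evalRingHom, eval_X, eval_zero] at hd
    rw [cycleMultiplier, ← hN] at hcyc
    rw [h2, eval_add, eval_mul, (heval N).2 dvd_rfl, mul_zero, add_zero, eval_finsetSum]
    simp_rw [eval_pow, hd, hcyc]
    obtain ⟨j, rfl⟩ := Nat.exists_eq_add_of_le' hj
    rw [Finset.sum_range_succ']
    simp
  have hv : ∀ p e : F[X], p = critOrbit F d N * e → eval α e ≠ 0 →
      p.rootMultiplicity α = (critOrbit F d N).rootMultiplicity α := by
    rintro p e rfl he
    have he0 : e ≠ 0 := by
      rintro rfl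
      simp at he
    rw [rootMultiplicity_mul (mul_ne_zero (critOrbit_monic hd hN0).ne_zero he0),
      rootMultiplicity_eq_zero he, add_zero]
  have hcompare : ∀ k, 0 < k →
      (preperiodicPoly d m ζ k).rootMultiplicity α = (critOrbit F d k).rootMultiplicity α := by
    intro k hk
    by_cases hNk : N ∣ k
    · obtain ⟨j, rfl⟩ := hNk
      obtain ⟨i, hi⟩ := hNm
      obtain ⟨e, he, he1⟩ := hmul j (pos_of_mul_pos_right hk (Nat.zero_le _))
      obtain ⟨e', he', he1'⟩ := hmul i (pos_of_mul_pos_right (by omega : 0 < N * i) (Nat.zero_le _))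
      obtain ⟨w, hw⟩ := sq_dvd_iterate_sub_iterate_zero hd (X : F[X]) (critOrbit F d (N * j))
        (k := m - 1) (by omega)
      rw [← critOrbit_add, ← critOrbit_eq_iterate, sub_eq_iff_eq_add] at hw
      rw [hv _ e he (by rw [he1]; exact one_ne_zero)]
      -- For N ∣ k, a_(m+k-1) = f^(m-1)(a_k) = a_(m-1) + a_k² w, so subtracting ζ a_(m-1) leaves a_N
      -- times a cofactor with value 1 - ζ ≠ 0 at `α`.
      refine hv _ (critOrbit F d N * e ^ 2 * w + C (1 - ζ) * e') ?_ ?_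
      · rw [preperiodicPoly, show m + N * j - 1 = N * j + (m - 1) by omega, hw, he, hi, he',
          C_sub, C_1]
        ring
      · rw [eval_add, eval_mul, eval_mul, (heval N).2 dvd_rfl, eval_mul, eval_C, he1']
        simpa [sub_eq_zero] using hζ1.symm
    · rw [rootMultiplicity_eq_zero, rootMultiplicity_eq_zero]
      · exact (heval k).not.2 hNk
      · have h1 := eval_critOrbit_add d (m - 1) k α
        have h2 := eval_critOrbit_add d 0 k α
        rw [h0] at h1
        rw [critOrbit, eval_zero, ← h1, zero_add] at h2
        rw [IsRoot, preperiodicPoly, eval_sub, eval_mul, h0, mul_zero, sub_zero,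
          show m + k - 1 = m - 1 + k by omega, ← h2]
        exact (heval k).not.2 hNk
  rw [misiurewiczOrder_eq hd hm, Finset.sum_congr rfl fun k hk => by
    rw [hcompare k (Nat.pos_of_mem_divisors hk)]]
  split_ifs with hnm
  · exact sub_self _
  · rw [sub_zero]
    -- Without the correction factor, the sum is the dynatomic order at 0, nonzero only for n = N;
    -- but N ∣ m - 1 and n ∤ m - 1.
    have key := (moebius_sum_rootMultiplicity d α 0 (fun k hk => by
      rw [sub_zero, ← critOrbit_eq_iterate]
      exact (critOrbit_monic hd hk).ne_zero) n hn).2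
    rw [eval_zero] at key
    simp_rw [sub_zero, ← critOrbit_eq_iterate] at key
    refine key fun hmem => hnm ?_
    rwa [eq_minimalPeriod_of_cycleMultiplier_eq_zero hcyc hmem, ← hN]

theorem misiurewiczOrder_nonneg {d m n : ℕ} (hd : 2 ≤ d) (hm : 2 ≤ m) (hn : 0 < n) {ζ : F}
    (hζ : ζ ^ d = 1) (hζ1 : ζ ≠ 1) (α : F) : 0 ≤ misiurewiczOrder d m n ζ α := by
  by_cases h0 : (critOrbit F d (m - 1)).eval α = 0
  · rw [misiurewiczOrder_of_eq_zero hd hm hn hζ1 h0]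
  · by_cases h : n ∈ dynatomicPeriods d α (ζ * (critOrbit F d (m - 1)).eval α)
    · exact ((misiurewiczOrder_of_ne_zero hd hm hn hζ h0).1 h).le
    · exact ((misiurewiczOrder_of_ne_zero hd hm hn hζ h0).2 h).ge

theorem misiurewiczOrder_pos_iff {d m n : ℕ} (hd : 2 ≤ d) (hm : 2 ≤ m) (hn : 0 < n) {ζ : F}
    (hζ : ζ ^ d = 1) (hζ1 : ζ ≠ 1) (α : F) :
    0 < misiurewiczOrder d m n ζ α ↔ (critOrbit F d (m - 1)).eval α ≠ 0 ∧
      n ∈ dynatomicPeriods d α (ζ * (critOrbit F d (m - 1)).eval α) := by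
  constructor
  · intro h
    have h0 : (critOrbit F d (m - 1)).eval α ≠ 0 := fun h0 =>
      h.ne' (misiurewiczOrder_of_eq_zero hd hm hn hζ1 h0)
    exact ⟨h0, by_contra fun h' => h.ne' ((misiurewiczOrder_of_ne_zero hd hm hn hζ h0).2 h')⟩
  · exact fun h => (misiurewiczOrder_of_ne_zero hd hm hn hζ h.1).1 h.2

/-- A polynomial `G` with `G * V = U` for the two products `U`, `V` vanishes exactly where the order
of `U / V` is positive. -/
theorem isRoot_iff_misiurewiczOrder_pos {d m n : ℕ} (hd : 2 ≤ d) (hm : 2 ≤ m) {ζ : F} {G : F[X]}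
    (hG : G * misiurewiczProd (-1) d m n ζ = misiurewiczProd 1 d m n ζ) (α : F) :
    G.IsRoot α ↔ 0 < misiurewiczOrder d m n ζ α := by
  have hne : G * misiurewiczProd (-1) d m n ζ ≠ 0 := by
    rw [hG]
    exact (misiurewiczProd_monic 1 hd hm n ζ).ne_zero
  rw [misiurewiczOrder, ← hG, rootMultiplicity_mul hne, ← rootMultiplicity_pos
    (left_ne_zero_of_mul hne)]
  push_cast
  omega

/-- A nonconstant denominator would have a root over `K`, not shared by the numerator, where the
order would be negative. -/
theorem denom_misiurewiczRat {K : Type*} [Field K] [IsAlgClosed K] (φ : F →+* K) {d m n : ℕ} (hd : 2 ≤ d) (hm : 2 ≤ m)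
    (hn : 0 < n) {ζ : F} (hζ : ζ ^ d = 1) (hζ1 : ζ ≠ 1) :
    (misiurewiczRat d m n ζ).denom = 1 := by
  set g := (misiurewiczRat d m n ζ).num with hg
  set h := (misiurewiczRat d m n ζ).denom with hh
  have hmul : g * misiurewiczProd (-1) d m n ζ = misiurewiczProd 1 d m n ζ * h :=
    num_mul_misiurewiczProd hd hm n ζ
  have hmonic : h.Monic := RatFunc.monic_denom _
  have hcop : IsCoprime g h := RatFunc.isCoprime_num_denom _
  by_contra hne
  have hdeg : h.degree ≠ 0 := fun hd => hne (hmonic.degree_le_zero_iff_eq_one.1 hd.le)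
  obtain ⟨α, hα⟩ := IsAlgClosed.exists_root (h.map φ) (by rwa [degree_map])
  have hmul' := congrArg (Polynomial.map φ) hmul
  rw [Polynomial.map_mul, Polynomial.map_mul, map_misiurewiczProd, map_misiurewiczProd] at hmul'
  have hU := (misiurewiczProd_monic 1 hd hm n (φ ζ)).ne_zero
  have hne1 : misiurewiczProd 1 d m n (φ ζ) * h.map φ ≠ 0 :=
    mul_ne_zero hU (hmonic.map φ).ne_zero
  have hord := congrArg (rootMultiplicity α) hmul'
  rw [rootMultiplicity_mul hne1, rootMultiplicity_mul (hmul' ▸ hne1)] at hord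
  have hgα : ¬ (g.map φ).IsRoot α := by
    intro hgα
    obtain ⟨a, b, hab⟩ := hcop.map (mapRingHom φ)
    have := congrArg (eval α) hab
    simp only [coe_mapRingHom] at this
    rw [eval_add, eval_mul, eval_mul, hgα.eq_zero, hα.eq_zero] at this
    simp at this
  rw [rootMultiplicity_eq_zero hgα] at hord
  have hpos := (rootMultiplicity_pos (hmonic.map φ).ne_zero).2 hα
  have hnn := misiurewiczOrder_nonneg hd hm hn (ζ := φ ζ) (by rw [← map_pow, hζ, map_one])
    (fun h => hζ1 (φ.injective (by rw [h, map_one]))) α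
  rw [misiurewiczOrder] at hnn
  omega

end field

/-! ### Misiurewicz polynomials over rings and their reductions -/

section misiurewiczPoly

variable {R : Type*} [CommRing R]

/-- The Misiurewicz polynomial over an arbitrary ring containing the root of unity, as the quotient
of the two products in `misiurewiczRat`. -/
def misiurewiczPoly (d m n : ℕ) (ζ : R) : R[X] :=
  misiurewiczProd 1 d m n ζ /ₘ misiurewiczProd (-1) d m n ζ

theorem map_misiurewiczPoly {S : Type*} [CommRing S] [Nontrivial R] (φ : R →+* S) {d m : ℕ}
    (hd : 2 ≤ d) (hm : 2 ≤ m) (n : ℕ) (ζ : R) :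
    (misiurewiczPoly d m n ζ).map φ = misiurewiczPoly d m n (φ ζ) := by
  rw [misiurewiczPoly, map_divByMonic _ (misiurewiczProd_monic _ hd hm n ζ),
    map_misiurewiczProd, map_misiurewiczProd, misiurewiczPoly]

/-- The product of the exponent `-1` factors divides the product of the exponent `1` factors. -/
def IsPolynomial (d m n : ℕ) (ζ : R) : Prop :=
  misiurewiczPoly d m n ζ * misiurewiczProd (-1) d m n ζ = misiurewiczProd 1 d m n ζ

theorem num_eq_misiurewiczPoly {F K : Type*} [Field F] [Field K] [IsAlgClosed K] (φ : F →+* K)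
    {d m n : ℕ} (hd : 2 ≤ d) (hm : 2 ≤ m) (hn : 0 < n) {ζ : F} (hζ : ζ ^ d = 1) (hζ1 : ζ ≠ 1) :
    (misiurewiczRat d m n ζ).num = misiurewiczPoly d m n ζ ∧ IsPolynomial d m n ζ := by
  have h := num_mul_misiurewiczProd hd hm n ζ
  rw [denom_misiurewiczRat φ hd hm hn hζ hζ1, mul_one] at h
  have h2 : (misiurewiczRat d m n ζ).num = misiurewiczPoly d m n ζ := by
    rw [misiurewiczPoly, ← h, mul_comm,
      mul_divByMonic_cancel_left _ (misiurewiczProd_monic _ hd hm n ζ)]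
  exact ⟨h2, by rwa [IsPolynomial, ← h2]⟩

/-- Divisibility by a monic polynomial survives any ring map. With `IsPolynomial.of_map` it descends
from ℂ to the algebraic integers and passes on to residue fields. -/
theorem IsPolynomial.map {S : Type*} [CommRing S] [Nontrivial R] {d m n : ℕ} {ζ : R}
    (h : IsPolynomial d m n ζ) (hd : 2 ≤ d) (hm : 2 ≤ m) (φ : R →+* S) :
    IsPolynomial d m n (φ ζ) := by
  have := congrArg (Polynomial.map φ) h
  rwa [Polynomial.map_mul, map_misiurewiczPoly φ hd hm, map_misiurewiczProd,
    map_misiurewiczProd] at this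

theorem IsPolynomial.of_map {S : Type*} [CommRing S] [Nontrivial R] {d m n : ℕ} {ζ : R}
    (φ : R →+* S) (hφ : Function.Injective φ) (h : IsPolynomial d m n (φ ζ)) (hd : 2 ≤ d)
    (hm : 2 ≤ m) : IsPolynomial d m n ζ := by
  apply Polynomial.map_injective φ hφ
  rwa [Polynomial.map_mul, map_misiurewiczPoly φ hd hm, map_misiurewiczProd, map_misiurewiczProd]

theorem IsPolynomial.monic [Nontrivial R] {d m n : ℕ} {ζ : R} (h : IsPolynomial d m n ζ)
    (hd : 2 ≤ d) (hm : 2 ≤ m) : (misiurewiczPoly d m n ζ).Monic :=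
  (misiurewiczProd_monic (-1) hd hm n ζ).of_mul_monic_right (h ▸ misiurewiczProd_monic 1 hd hm n ζ)

/-- The multiplier as a polynomial in the parameter. -/
def multiplierInParam (R : Type*) [CommRing R] (d m n : ℕ) : R[X] :=
  (d : R[X]) ^ n * (∏ i ∈ Finset.range n, critOrbit R d (m + i)) ^ (d - 1)

theorem map_multiplierInParam {S : Type*} [CommRing S] (φ : R →+* S) (d m n : ℕ) :
    (multiplierInParam R d m n).map φ = multiplierInParam S d m n := by
  simp [multiplierInParam, Polynomial.map_prod, map_critOrbit]

theorem eval_multiplierInParam (d m n : ℕ) (c : ℂ) :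
    (multiplierInParam ℂ d m n).eval c = multiplier d m n c := by
  simp [multiplierInParam, multiplier, eval_prod]

end misiurewiczPoly

section field

variable {F : Type*} [Field F]

theorem IsPolynomial.isRoot_iff {d m n : ℕ} {ζ : F} (h : IsPolynomial d m n ζ) (hd : 2 ≤ d)
    (hm : 2 ≤ m) (hn : 0 < n) (hζ : ζ ^ d = 1) (hζ1 : ζ ≠ 1) (α : F) :
    (misiurewiczPoly d m n ζ).IsRoot α ↔ (critOrbit F d (m - 1)).eval α ≠ 0 ∧
      n ∈ dynatomicPeriods d α (ζ * (critOrbit F d (m - 1)).eval α) :=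
  (isRoot_iff_misiurewiczOrder_pos hd hm h α).trans (misiurewiczOrder_pos_iff hd hm hn hζ hζ1 α)

theorem iterate_succ_mul_eval_critOrbit {d m : ℕ} (hm : 2 ≤ m) {ζ : F} (hζ : ζ ^ d = 1) (α : F)
    (i : ℕ) : (fun z : F => z ^ d + α)^[i + 1] (ζ * (critOrbit F d (m - 1)).eval α) =
      (critOrbit F d (m + i)).eval α := by
  rw [eval_critOrbit_add, Function.iterate_succ_apply]
  obtain ⟨m, rfl⟩ := Nat.exists_eq_add_of_le' (by omega : 1 ≤ m)
  simp [mul_pow, hζ, critOrbit]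

theorem iterDeriv_eq_eval_multiplierInParam {d m n : ℕ} (hm : 2 ≤ m) {ζ : F}
    (hζ : ζ ^ d = 1) (α : F)
    (hper : Function.IsPeriodicPt (fun z : F => z ^ d + α) n
      (ζ * (critOrbit F d (m - 1)).eval α)) :
    iterDeriv d α (ζ * (critOrbit F d (m - 1)).eval α) n =
      (multiplierInParam F d m n).eval α := by
  have hshift : iterDeriv d α (ζ * (critOrbit F d (m - 1)).eval α) n =
      ∏ i ∈ Finset.range n, (d : F) * ((critOrbit F d (m + i)).eval α) ^ (d - 1) := by
    simp_rw [← iterate_succ_mul_eval_critOrbit hm hζ α]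
    rcases n with _ | n
    · simp [iterDeriv]
    -- The two products run over the same cycle, shifted by one: periodicity identifies the first
    -- factor of one with the last of the other.
    · rw [iterDeriv, Finset.prod_range_succ', Finset.prod_range_succ, hper.eq]
      rfl
  rw [hshift, Finset.prod_mul_distrib, Finset.prod_pow, multiplierInParam]
  simp [eval_prod]

/-- If the multiplier of the cycle of length `ℓ` is a root of the `s`-th cyclotomic polynomial, then
a root of the `ℓ`-th Misiurewicz polynomial is a root of the `(ℓ * s)`-th one. -/
theorem isRoot_misiurewiczPoly_mul {d m ℓ s : ℕ} (hd : 2 ≤ d) (hm : 2 ≤ m) (hℓ : 0 < ℓ)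
    (hs : 2 ≤ s) {ζ α : F} (hζ : ζ ^ d = 1) (hζ1 : ζ ≠ 1) (h1 : IsPolynomial d m ℓ ζ)
    (h2 : IsPolynomial d m (ℓ * s) ζ) (hroot : (misiurewiczPoly d m ℓ ζ).IsRoot α)
    (hcyc : (cyclotomic s F).IsRoot ((multiplierInParam F d m ℓ).eval α)) :
    (misiurewiczPoly d m (ℓ * s) ζ).IsRoot α := by
  rw [h1.isRoot_iff hd hm hℓ hζ hζ1] at hroot
  rw [h2.isRoot_iff hd hm (Nat.mul_pos hℓ (by omega)) hζ hζ1]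
  rw [← iterDeriv_eq_eval_multiplierInParam hm hζ α
    (isPeriodicPt_of_mem_dynatomicPeriods hroot.2)] at hcyc
  exact ⟨hroot.1, mul_mem_dynatomicPeriods d α _ hroot.2 hs hcyc⟩

/-- Let `ζ ≠ 1` be a `d`-th root of unity in a domain, reduced to a field `F`. If the reduction of
the multiplier at a root `α` of the `ℓ`-th Misiurewicz polynomial is a root of the `s`-th
cyclotomic polynomial, then the `(ℓ * s)`-th Misiurewicz polynomial vanishes at `α` in `F`. -/
theorem map_eval_misiurewiczPoly_mul_eq_zero {A : Type*} [CommRing A] [IsDomain A] (ψ : A →+* F)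
    {d m ℓ s : ℕ} (hd : 2 ≤ d) (hm : 2 ≤ m) (hℓ : 0 < ℓ)
    (hs : 2 ≤ s) {ζ α : A} (hζ : ζ ^ d = 1) (hζ1 : ζ ≠ 1) (h1 : IsPolynomial d m ℓ ζ)
    (h2 : IsPolynomial d m (ℓ * s) ζ) (hroot : (misiurewiczPoly d m ℓ ζ).IsRoot α)
    (hcyc : ψ ((cyclotomic s A).eval ((multiplierInParam A d m ℓ).eval α)) = 0) :
    ψ ((misiurewiczPoly d m (ℓ * s) ζ).eval α) = 0 := by
  have hcyc' : (cyclotomic s F).IsRoot ((multiplierInParam F d m ℓ).eval (ψ α)) := by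
    rwa [← eval_map_apply, ← eval_map_apply, map_cyclotomic, map_multiplierInParam] at hcyc
  -- If d = 0 in `F`, the multiplier reduces to 0, but Φ_s(0) = 1.
  have hd0 : (d : F) ≠ 0 := by
    intro h0
    rw [multiplierInParam, ← C_eq_natCast, h0, C_0, zero_pow hℓ.ne', zero_mul, eval_zero, IsRoot,
      ← coeff_zero_eq_eval_zero, cyclotomic_coeff_zero _ (by omega)] at hcyc'
    exact one_ne_zero hcyc'
  -- The sum of ζ^i over i < d is 0; if ζ reduced to 1, it would reduce to d.
  have hψζ : ψ ζ ≠ 1 := by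
    intro h
    apply hd0
    have hsum : (∑ i ∈ Finset.range d, ζ ^ i) * (ζ - 1) = 0 := by rw [geom_sum_mul, hζ, sub_self]
    have := congrArg ψ ((mul_eq_zero.1 hsum).resolve_right (sub_ne_zero.2 hζ1))
    simpa [h] using this
  rw [← eval_map_apply, map_misiurewiczPoly ψ hd hm]
  refine isRoot_misiurewiczPoly_mul hd hm hℓ hs (by rw [← map_pow, hζ, map_one]) hψζ
    (h1.map hd hm ψ) (h2.map hd hm ψ) ?_ hcyc'
  rw [← map_misiurewiczPoly ψ hd hm]
  exact hroot.map

end field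

/-! ### Algebraic integers, units and conjugates -/

/-- ℤ[ζ] is the full ring of integers of the cyclotomic field ℚ(ζ). -/
theorem mem_adjoin_int_of_isIntegral {ζ : ℂ} {d : ℕ} (hd : 0 < d) (hζ : ζ ^ d = 1) {x : ℂ}
    (hx : x ∈ ℚ⟮ζ⟯) (hint : IsIntegral ℤ x) : x ∈ Algebra.adjoin ℤ {ζ} := by
  have hfin : IsOfFinOrder ζ := isOfFinOrder_iff_pow_eq_one.2 ⟨d, hd, hζ⟩
  have : NeZero (orderOf ζ) := ⟨hfin.orderOf_pos.ne'⟩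
  have hprim : IsPrimitiveRoot ζ (orderOf ζ) := IsPrimitiveRoot.orderOf ζ
  have hζint : IsIntegral ℚ ζ := ⟨X ^ d - 1, monic_X_pow_sub_C 1 hd.ne', by simp [hζ]⟩
  have hcyc : IsCyclotomicExtension {orderOf ζ} ℚ ℚ⟮ζ⟯ := by
    change IsCyclotomicExtension {orderOf ζ} ℚ ℚ⟮ζ⟯.toSubalgebra
    rw [IntermediateField.adjoin_simple_toSubalgebra_of_isAlgebraic hζint.isAlgebraic]
    exact hprim.adjoin_isCyclotomicExtension ℚ
  have hgen : IsPrimitiveRoot (IntermediateField.AdjoinSimple.gen ℚ ζ) (orderOf ζ) :=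
    IsPrimitiveRoot.coe_submonoidClass_iff.1 hprim
  have hcl := IsCyclotomicExtension.Rat.isIntegralClosure_adjoin_singleton hgen
  have hx' : IsIntegral ℤ (⟨x, hx⟩ : ℚ⟮ζ⟯) :=
    (isIntegral_algHom_iff (ℚ⟮ζ⟯.val.restrictScalars ℤ) Subtype.val_injective).1 hint
  obtain ⟨y, hy⟩ := hcl.isIntegral_iff.1 hx'
  have hmap := (Subalgebra.mem_map (f := ℚ⟮ζ⟯.val.restrictScalars ℤ)).2
    ⟨(y : ℚ⟮ζ⟯), y.2, rfl⟩
  rw [AlgHom.map_adjoin_singleton] at hmap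
  have hyx : (y : ℚ⟮ζ⟯) = ⟨x, hx⟩ := hy
  rw [hyx] at hmap
  exact hmap

theorem isUnit_integralClosure_iff {x : integralClosure ℤ ℂ} :
    IsUnit x ↔ (x : ℂ) ≠ 0 ∧ IsIntegral ℤ (x : ℂ)⁻¹ := by
  constructor
  · intro h
    obtain ⟨y, hy⟩ := isUnit_iff_exists_inv.1 h
    have hy' : (x : ℂ) * y = 1 := congrArg Subtype.val hy
    exact ⟨left_ne_zero_of_mul_eq_one hy', (eq_inv_of_mul_eq_one_right hy') ▸ y.2⟩
  · rintro ⟨h0, hi⟩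
    exact IsUnit.of_mul_eq_one ⟨(x : ℂ)⁻¹, hi⟩ (Subtype.ext (mul_inv_cancel₀ h0))

theorem exists_multiset_roots_integralClosure {p : (integralClosure ℤ ℂ)[X]} (hp : p.Monic) :
    ∃ S : Multiset (integralClosure ℤ ℂ), p = (S.map fun a => X - C a).prod ∧
      (p.map (algebraMap (integralClosure ℤ ℂ) ℂ)).roots = S.map Subtype.val := by
  set φ := algebraMap (integralClosure ℤ ℂ) ℂ
  have hroots : ∀ c ∈ (p.map φ).roots, c ∈ integralClosure ℤ ℂ := by
    intro c hc
    have hc' := (mem_roots'.1 hc).2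
    rw [IsRoot, eval_map] at hc'
    exact isIntegral_trans (R := ℤ) (A := integralClosure ℤ ℂ) c ⟨p, hp, hc'⟩
  obtain ⟨S, hS⟩ := CanLift.prf (β := Multiset (integralClosure ℤ ℂ)) (p.map φ).roots hroots
  refine ⟨S, map_injective φ Subtype.val_injective ?_, hS.symm⟩
  have hsplit := (IsAlgClosed.splits (p.map φ)).eq_prod_roots_of_monic (hp.map φ)
  rw [← hS] at hsplit
  rw [hsplit, Polynomial.map_multiset_prod, Multiset.map_map, Multiset.map_map]
  congr 1
  exact Multiset.map_congr rfl fun a _ => by simp [φ]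

theorem isUnit_multiset_prod_iff {M : Type*} [CommMonoid M] {S : Multiset M} :
    IsUnit S.prod ↔ ∀ x ∈ S, IsUnit x :=
  ⟨fun h _ hx => isUnit_of_dvd_unit (Multiset.dvd_prod hx) h,
    fun h => Multiset.prod_induction _ _ (fun _ _ => IsUnit.mul) isUnit_one h⟩

/-- Two products of linear factors: the values of either one at the roots of the other are units
exactly when all differences of roots are. -/
theorem isUnit_eval_swap {A : Type*} [CommRing A] {p q : A[X]} {S T : Multiset A}
    (hp : p = (S.map fun a => X - C a).prod) (hq : q = (T.map fun a => X - C a).prod)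
    (h : ∀ b ∈ T, IsUnit (p.eval b)) : ∀ a ∈ S, IsUnit (q.eval a) := by
  intro a ha
  rw [hq, eval_multiset_prod, isUnit_multiset_prod_iff]
  simp only [Multiset.map_map, Multiset.mem_map, Function.comp_apply, eval_sub, eval_X, eval_C,
    forall_exists_index, and_imp, forall_apply_eq_imp_iff₂]
  intro b hb
  have hab := h b hb
  rw [hp, eval_multiset_prod, isUnit_multiset_prod_iff] at hab
  have := hab (b - a) (by
    simp only [Multiset.map_map, Multiset.mem_map]
    exact ⟨a, ha, by simp⟩)
  rw [← neg_sub]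
  exact this.neg

/-- Being nonzero with integral inverse passes between conjugates. -/
theorem isIntegral_inv_aeval_of_conj {L : Type*} [Field L] [Algebra L ℂ] {p : L[X]}
    (hp : Irreducible p) (q : L[X]) {a b : ℂ} (ha : aeval a p = 0) (hb : aeval b p = 0)
    (h : aeval a q ≠ 0 ∧ IsIntegral ℤ (aeval a q)⁻¹) :
    aeval b q ≠ 0 ∧ IsIntegral ℤ (aeval b q)⁻¹ := by
  have : Fact (Irreducible p) := ⟨hp⟩
  let σ : AdjoinRoot p →+* ℂ := AdjoinRoot.lift (algebraMap L ℂ) a (by rwa [← aeval_def])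
  let τ : AdjoinRoot p →+* ℂ := AdjoinRoot.lift (algebraMap L ℂ) b (by rwa [← aeval_def])
  have hσ : σ (AdjoinRoot.mk p q) = aeval a q := by simp [σ, aeval_def]
  have hτ : τ (AdjoinRoot.mk p q) = aeval b q := by simp [τ, aeval_def]
  rw [← hσ, ← map_inv₀] at h
  rw [← hτ, ← map_inv₀]
  refine ⟨(map_ne_zero τ).2 ((map_ne_zero σ).1 h.1), ?_⟩
  exact ((isIntegral_algHom_iff σ.toIntAlgHom σ.injective).1 h.2).map τ.toIntAlgHom

/-! ### The resultant as a product over roots -/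

section resultant

theorem resultant_multiplierPoly (d m ℓ s : ℕ) (ζ : ℂ) :
    resultant (multiplierPoly d m ℓ ζ) (cyclotomic s ℂ) =
      (((misiurewicz d m ℓ ζ).aroots ℂ).map fun c =>
        (cyclotomic s ℂ).eval (multiplier d m ℓ c)).prod := by
  have hP : multiplierPoly d m ℓ ζ =
      ((((misiurewicz d m ℓ ζ).aroots ℂ).map (multiplier d m ℓ)).map fun x => X - C x).prod := by
    rw [multiplierPoly, Multiset.map_map]
    rfl
  have hmonic : (multiplierPoly d m ℓ ζ).Monic := by
    rw [hP]
    exact monic_multisetProd_X_sub_C _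
  have hroots : (multiplierPoly d m ℓ ζ).roots =
      ((misiurewicz d m ℓ ζ).aroots ℂ).map (multiplier d m ℓ) := by
    rw [hP, roots_multiset_prod_X_sub_C]
  rw [resultant_eq_prod_eval _ _ _ le_rfl (IsAlgClosed.splits _), hmonic.leadingCoeff, one_pow,
    one_mul, hroots, Multiset.map_map]
  rfl

/-- The product is a resultant of polynomials over `L`. -/
theorem prod_eval_aroots_mem {L : IntermediateField ℚ ℂ} {p : L[X]} (hp : p.Monic) (q : L[X]) :
    ((p.aroots ℂ).map fun c => aeval c q).prod ∈ L := by
  have h := resultant_eq_prod_eval (p.map (algebraMap L ℂ)) (q.map (algebraMap L ℂ)) _ le_rfl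
    (IsAlgClosed.splits _)
  rw [(hp.map (algebraMap L ℂ)).leadingCoeff, one_pow, one_mul, resultant_map_map] at h
  simp_rw [eval_map_algebraMap] at h
  rw [aroots, ← h]
  exact SetLike.coe_mem _

end resultant

/-! ### Misiurewicz polynomials over ℂ and over ℚ(ζ) -/

theorem isPolynomial_complex {d m n : ℕ} (hd : 2 ≤ d) (hm : 2 ≤ m) (hn : 0 < n) {ζ : ℂ}
    (hζ : ζ ^ d = 1) (hζ1 : ζ ≠ 1) : IsPolynomial d m n ζ :=
  (num_eq_misiurewiczPoly (RingHom.id ℂ) hd hm hn hζ hζ1).2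

theorem misiurewicz_eq {d m n : ℕ} (hd : 2 ≤ d) (hm : 2 ≤ m) (hn : 0 < n) {ζ : ℂ}
    (hζ : ζ ^ d = 1) (hζ1 : ζ ≠ 1) :
    misiurewicz d m n ζ = misiurewiczPoly d m n (IntermediateField.AdjoinSimple.gen ℚ ζ) := by
  refine (num_eq_misiurewiczPoly (algebraMap ℚ⟮ζ⟯ ℂ) hd hm hn ?_ ?_).1
  · exact Subtype.val_injective hζ
  · exact fun h => hζ1 (congrArg Subtype.val h)

theorem map_misiurewicz {d m n : ℕ} (hd : 2 ≤ d) (hm : 2 ≤ m) (hn : 0 < n) {ζ : ℂ}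
    (hζ : ζ ^ d = 1) (hζ1 : ζ ≠ 1) :
    (misiurewicz d m n ζ).map (algebraMap ℚ⟮ζ⟯ ℂ) = misiurewiczPoly d m n ζ := by
  rw [misiurewicz_eq hd hm hn hζ hζ1, map_misiurewiczPoly _ hd hm]
  rfl

theorem aeval_misiurewicz {d m n : ℕ} (hd : 2 ≤ d) (hm : 2 ≤ m) (hn : 0 < n) {ζ : ℂ}
    (hζ : ζ ^ d = 1) (hζ1 : ζ ≠ 1) (c : ℂ) :
    aeval c (misiurewicz d m n ζ) = (misiurewiczPoly d m n ζ).eval c := by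
  rw [← map_misiurewicz hd hm hn hζ hζ1, eval_map_algebraMap]

theorem misiurewicz_monic {d m n : ℕ} (hd : 2 ≤ d) (hm : 2 ≤ m) (hn : 0 < n) {ζ : ℂ}
    (hζ : ζ ^ d = 1) (hζ1 : ζ ≠ 1) : (misiurewicz d m n ζ).Monic := by
  refine monic_of_injective (algebraMap ℚ⟮ζ⟯ ℂ).injective ?_
  rw [map_misiurewicz hd hm hn hζ hζ1]
  exact (isPolynomial_complex hd hm hn hζ hζ1).monic hd hm

theorem eval_critOrbit_mem {K : IntermediateField ℚ ℂ} {c : ℂ} (hc : c ∈ K) (d i : ℕ) :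
    (critOrbit ℂ d i).eval c ∈ K := by
  induction i with
  | zero => simp [critOrbit]
  | succ i ih =>
    simp only [critOrbit, eval_add, eval_pow, eval_X]
    exact add_mem (pow_mem ih d) hc

/-- The root of unity `ζ` lies in the field generated by any root of `misiurewiczPoly`. -/
theorem mem_adjoin_of_isRoot {d m n : ℕ} (hd : 2 ≤ d) (hm : 2 ≤ m) (hn : 0 < n) {ζ : ℂ}
    (hζ : ζ ^ d = 1) (hζ1 : ζ ≠ 1) {c : ℂ} (hc : (misiurewiczPoly d m n ζ).IsRoot c) :
    ζ ∈ ℚ⟮c⟯ := by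
  obtain ⟨h0, hmem⟩ := ((isPolynomial_complex hd hm hn hζ hζ1).isRoot_iff hd hm hn hζ hζ1 c).1 hc
  have hper := (isPeriodicPt_of_mem_dynatomicPeriods hmem).eq
  obtain ⟨k, rfl⟩ := Nat.exists_eq_add_of_le' hn
  rw [iterate_succ_mul_eval_critOrbit hm hζ] at hper
  -- At a root, a_(m+n-1) = ζ a_(m-1) with a_(m-1) ≠ 0.
  rw [eq_div_of_mul_eq h0 hper.symm]
  have hcK := IntermediateField.mem_adjoin_simple_self ℚ c
  exact div_mem (eval_critOrbit_mem hcK _ _) (eval_critOrbit_mem hcK _ _)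

/-- Reduction modulo maximal ideals of the ring of all algebraic integers: if the value of the
`(ℓ * s)`-th Misiurewicz polynomial at a root `α` of the `ℓ`-th one is a unit, then so is the value
of the `s`-th cyclotomic polynomial at the multiplier. -/
theorem isUnit_eval_cyclotomic {A : Type*} [CommRing A] [IsDomain A]
    {d m ℓ s : ℕ} (hd : 2 ≤ d) (hm : 2 ≤ m) (hℓ : 0 < ℓ)
    (hs : 2 ≤ s) {ζ α : A} (hζ : ζ ^ d = 1) (hζ1 : ζ ≠ 1) (h1 : IsPolynomial d m ℓ ζ)
    (h2 : IsPolynomial d m (ℓ * s) ζ) (hroot : (misiurewiczPoly d m ℓ ζ).IsRoot α)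
    (hunit : IsUnit ((misiurewiczPoly d m (ℓ * s) ζ).eval α)) :
    IsUnit ((cyclotomic s A).eval ((multiplierInParam A d m ℓ).eval α)) := by
  by_contra hnot
  obtain ⟨P, hP, hmem⟩ := exists_max_ideal_of_mem_nonunits hnot
  let := Ideal.Quotient.field P
  have h0 := map_eval_misiurewiczPoly_mul_eq_zero (Ideal.Quotient.mk P) hd hm hℓ hs hζ hζ1 h1 h2
    hroot (Ideal.Quotient.eq_zero_iff_mem.2 hmem)
  exact hP.ne_top (Ideal.eq_top_of_isUnit_mem _ (Ideal.Quotient.eq_zero_iff_mem.1 h0) hunit)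

end Misiurewicz

end

/-! ### The main theorem -/

open Misiurewicz

theorem proposition5p3 (d m n : ℕ) (hd : 2 ≤ d) (hm : 2 ≤ m) (hn : 2 ≤ n)
    (ζ : ℂ) (hζ : ζ ^ d = 1) (hζ1 : ζ ≠ 1)
    (c₀ : ℂ) (hc₀ : aeval c₀ (Misiurewicz.misiurewicz d m n ζ) = 0)
    (hirr : ∀ t : ℕ, t ∣ n → Irreducible (Misiurewicz.misiurewicz d m t ζ))
    (ℓ : ℕ) (hℓ : ℓ ∣ n) (hℓn : ℓ ≠ n)
    (hres : ∀ r : Algebra.adjoin ℤ {ζ},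
      (r : ℂ) = resultant (Misiurewicz.multiplierPoly d m ℓ ζ) (cyclotomic (n / ℓ) ℂ) →
        ¬ IsUnit r) :
    ∃ g : 𝓞 ℚ⟮c₀⟯,
      ((g : ℚ⟮c₀⟯) : ℂ) = aeval c₀ (Misiurewicz.misiurewicz d m ℓ ζ) ∧ ¬ IsUnit g := by
  have hn0 : 0 < n := by omega
  obtain ⟨s, hs⟩ := hℓ
  have hℓ0 : 0 < ℓ := Nat.pos_of_ne_zero (by rintro rfl; omega)
  have hs2 : 2 ≤ s := by
    by_contra h
    interval_cases s <;> omega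
  have hdiv : n / ℓ = s := by rw [hs, Nat.mul_div_cancel_left _ hℓ0]
  let A := integralClosure ℤ ℂ
  let ι : A →+* ℂ := algebraMap A ℂ
  have hι : Function.Injective ι := Subtype.val_injective
  obtain ⟨ζA, hζA⟩ : ∃ z : A, ι z = ζ :=
    ⟨⟨ζ, X ^ d - 1, monic_X_pow_sub_C 1 (by omega), by simp [hζ]⟩, rfl⟩
  have hζAd : ζA ^ d = 1 := hι (by rw [map_pow, hζA, hζ, map_one])
  have hζA1 : ζA ≠ 1 := fun h => hζ1 (by rw [← hζA, h, map_one])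
  have hpoly : ∀ t, 0 < t → IsPolynomial d m t ζA := fun t ht =>
    IsPolynomial.of_map ι hι (by rw [hζA]; exact isPolynomial_complex hd hm ht hζ hζ1) hd hm
  have hmap : ∀ t, (misiurewiczPoly d m t ζA).map ι = misiurewiczPoly d m t ζ := fun t => by
    rw [map_misiurewiczPoly ι hd hm, hζA]
  have hι_eval : ∀ t (a : A), ι ((misiurewiczPoly d m t ζA).eval a) =
      (misiurewiczPoly d m t ζ).eval (ι a) := fun t a => by rw [← hmap, eval_map_apply]
  obtain ⟨S, hS, hSroots⟩ := exists_multiset_roots_integralClosure ((hpoly ℓ hℓ0).monic hd hm)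
  obtain ⟨T, hT, hTroots⟩ := exists_multiset_roots_integralClosure ((hpoly n hn0).monic hd hm)
  have hrootA : ∀ t, 0 < t → ∀ U : Multiset A,
      misiurewiczPoly d m t ζA = (U.map fun a => X - C a).prod →
      ∀ a, (misiurewiczPoly d m t ζA).IsRoot a ↔ a ∈ U := by
    intro t ht U hU a
    rw [hU, ← mem_roots (monic_multisetProd_X_sub_C U).ne_zero, roots_multiset_prod_X_sub_C]
  rw [aeval_misiurewicz hd hm hn0 hζ hζ1] at hc₀
  have hζK : ζ ∈ ℚ⟮c₀⟯ := mem_adjoin_of_isRoot hd hm hn0 hζ hζ1 hc₀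
  obtain ⟨b₀, hb₀⟩ : ∃ b : A, ι b = c₀ := by
    have : c₀ ∈ ((misiurewiczPoly d m n ζA).map ι).roots := by
      rw [mem_roots (((hpoly n hn0).monic hd hm).map ι).ne_zero, hmap]
      exact hc₀
    rw [hTroots, Multiset.mem_map] at this
    obtain ⟨b, _, hb⟩ := this
    exact ⟨b, hb⟩
  let κ : ℚ⟮c₀⟯ →+* ℂ := algebraMap ℚ⟮c₀⟯ ℂ
  -- As ζ lies in K, the value G_ℓ(c₀) can be formed inside K.
  let u : ℚ⟮c₀⟯ := (misiurewiczPoly d m ℓ (⟨ζ, hζK⟩ : ℚ⟮c₀⟯)).eval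
    (IntermediateField.AdjoinSimple.gen ℚ c₀)
  have hu : κ u = (misiurewiczPoly d m ℓ ζ).eval c₀ := by
    rw [← eval_map_apply, map_misiurewiczPoly κ hd hm]
    rfl
  have hu' : κ u = ι ((misiurewiczPoly d m ℓ ζA).eval b₀) := by rw [hu, hι_eval, hb₀]
  have huint : IsIntegral ℤ u := by
    refine (isIntegral_algHom_iff κ.toIntAlgHom κ.injective).1 ?_
    change IsIntegral ℤ (κ u)
    rw [hu']
    exact ((misiurewiczPoly d m ℓ ζA).eval b₀).2
  refine ⟨⟨u, huint⟩, ?_, fun hunit => ?_⟩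
  · rw [aeval_misiurewicz hd hm hℓ0 hζ hζ1]
    exact hu
  have hunit₀ : IsUnit ((misiurewiczPoly d m ℓ ζA).eval b₀) := by
    obtain ⟨w, hw⟩ := isUnit_iff_exists_inv.1 hunit
    have hw' : κ u * κ (w : ℚ⟮c₀⟯) = 1 := by
      rw [← map_mul, ← map_one κ]
      exact congrArg κ (congrArg Subtype.val hw)
    rw [isUnit_integralClosure_iff]
    change ι _ ≠ 0 ∧ IsIntegral ℤ (ι _)⁻¹
    rw [← hu']
    refine ⟨left_ne_zero_of_mul_eq_one hw', ?_⟩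
    rw [← eq_inv_of_mul_eq_one_right hw']
    exact w.2.map κ.toIntAlgHom
  have hunitT : ∀ b ∈ T, IsUnit ((misiurewiczPoly d m ℓ ζA).eval b) := by
    intro b hb
    have hb0 := congrArg ι ((hrootA n hn0 T hT b).2 hb).eq_zero
    rw [hι_eval, map_zero, ← aeval_misiurewicz hd hm hn0 hζ hζ1] at hb0
    rw [← aeval_misiurewicz hd hm hn0 hζ hζ1] at hc₀
    have h := isUnit_integralClosure_iff.1 hunit₀
    change ι _ ≠ 0 ∧ IsIntegral ℤ (ι _)⁻¹ at h
    rw [hι_eval, hb₀, ← aeval_misiurewicz hd hm hℓ0 hζ hζ1] at h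
    have h2 := isIntegral_inv_aeval_of_conj (hirr n dvd_rfl) _ hc₀ hb0 h
    rw [aeval_misiurewicz hd hm hℓ0 hζ hζ1, ← hι_eval] at h2
    exact isUnit_integralClosure_iff.2 h2
  have hunitS : ∀ a ∈ S,
      IsUnit ((cyclotomic s A).eval ((multiplierInParam A d m ℓ).eval a)) := by
    intro a ha
    refine isUnit_eval_cyclotomic hd hm hℓ0 hs2 hζAd hζA1 (hpoly ℓ hℓ0) (hs ▸ hpoly n hn0)
      ((hrootA ℓ hℓ0 S hS a).2 ha) ?_
    rw [← hs]
    exact isUnit_eval_swap hS hT hunitT a ha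
  let ρ : A := (S.map fun a => (cyclotomic s A).eval ((multiplierInParam A d m ℓ).eval a)).prod
  have hρunit : IsUnit ρ := by
    rw [isUnit_multiset_prod_iff]
    simpa only [Multiset.mem_map, forall_exists_index, and_imp, forall_apply_eq_imp_iff₂]
      using hunitS
  have haroots : (misiurewicz d m ℓ ζ).aroots ℂ = S.map ι := by
    rw [aroots, map_misiurewicz hd hm hℓ0 hζ hζ1, ← hmap]
    exact hSroots
  have hρ : ι ρ = resultant (multiplierPoly d m ℓ ζ) (cyclotomic s ℂ) := by
    rw [resultant_multiplierPoly, haroots, map_multiset_prod, Multiset.map_map, Multiset.map_map]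
    congr 1
    refine Multiset.map_congr rfl fun a _ => ?_
    simp only [Function.comp_apply]
    rw [← eval_map_apply, ← eval_map_apply, map_cyclotomic, map_multiplierInParam,
      eval_multiplierInParam]
  have hρmem : ι ρ ∈ ℚ⟮ζ⟯ := by
    have := prod_eval_aroots_mem (misiurewicz_monic hd hm hℓ0 hζ hζ1)
      ((cyclotomic s ℚ⟮ζ⟯).comp (multiplierInParam ℚ⟮ζ⟯ d m ℓ))
    rw [hρ, resultant_multiplierPoly]
    convert this using 4 with c
    rw [aeval_comp, ← eval_map_algebraMap, ← eval_map_algebraMap, map_cyclotomic,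
      map_multiplierInParam, eval_multiplierInParam]
  obtain ⟨hρ0, hρinv⟩ := isUnit_integralClosure_iff.1 hρunit
  have hd0 : 0 < d := by omega
  let r : Algebra.adjoin ℤ {ζ} := ⟨ι ρ, mem_adjoin_int_of_isIntegral hd0 hζ hρmem ρ.2⟩
  let r' : Algebra.adjoin ℤ {ζ} :=
    ⟨(ι ρ)⁻¹, mem_adjoin_int_of_isIntegral hd0 hζ (inv_mem hρmem) hρinv⟩
  -- Both the resultant and its inverse are integral and lie in ℚ(ζ), hence in ℤ[ζ].
  refine hres r (by rw [hdiv, ← hρ]) (IsUnit.of_mul_eq_one r' (Subtype.ext ?_))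
  exact mul_inv_cancel₀ hρ0
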